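/- Let $n\ge 2$, and let $A\in\mathbb{R}^{n\times k}$ and $B\in\mathbb{R}^{n\times l}$ be real matrices of rank $n$ with columns $\boldsymbol a_1,\dots,\boldsymbol a_k$ and $\boldsymbol b_1,\dots,\boldsymbol b_l$. Let $\mathcal Z(A)=\{\sum_i t_i\boldsymbol a_i \mid 0\le t_i\le 1\}$ and $\mathcal Z(B)=\{\sum_i t_i\boldsymbol b_i \mid 0\le t_i\le 1\}$ be the $n$-dimensional zonotopes in $\mathbb{R}^n$ that they generate. Suppose that $\mathcal Z(A)$ and $\mathcal Z(B)$ are combinatorially equivalent through an isomorphism $\varphi$ from the face lattice of $\mathcal Z(A)$ to the face lattice of $\mathcal Z(B)$ (faces ordered by inclusion), such that for every facet $F$ of $\mathcal Z(A)$ the corresponding facet $\varphi(F)$ of $\mathcal Z(B)$ has the same outward-pointing unit normal vector and the same $(n-1)$-dimensional volume as $F$. Then $\mathcal Z(A)$ and $\mathcal Z(B)$ are congruent, that is, some isometry of $\mathbb{R}^n$ maps $\mathcal Z(A)$ onto $\mathcal Z(B)$. -/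

import Mathlib

open scoped MeasureTheory

/-- The zonotope `{∑ tᵢ aᵢ | 0 ≤ tᵢ ≤ 1}` generated by the columns `aᵢ` of the matrix `A`. -/
def zonotope {n k : ℕ} (A : Matrix (Fin n) (Fin k) ℝ) : Set (EuclideanSpace ℝ (Fin n)) :=
  {x | ∃ t : Fin k → ℝ, (∀ i, 0 ≤ t i ∧ t i ≤ 1) ∧ x = ∑ i, t i • WithLp.toLp 2 (A.col i)}

/-- The faces of a convex polytope `P`, ordered by inclusion: the intersections of `P` with its
supporting hyperplanes, together with `P` itself and the empty set. -/
abbrev FaceLattice {n : ℕ} (P : Set (EuclideanSpace ℝ (Fin n))) : Type :=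
  {F : Set (EuclideanSpace ℝ (Fin n)) // IsExposed ℝ P F}

/-- `F` is a facet of the polytope `P`: a nonempty face whose dimension is one less than that
of `P`. -/
def IsFacet {n : ℕ} (P F : Set (EuclideanSpace ℝ (Fin n))) : Prop :=
  IsExposed ℝ P F ∧ F.Nonempty ∧
    Module.finrank ℝ (vectorSpan ℝ F) + 1 = Module.finrank ℝ (vectorSpan ℝ P)

/-- `u` is a unit vector, and on `P` the functional `⟪u, ·⟫` is maximal at every point of `F`.
If `F` is a facet of a polytope `P` with nonempty interior, this singles out the outward-pointing
unit normal vector of `F`. -/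
def IsOutwardUnitNormal {n : ℕ} (P F : Set (EuclideanSpace ℝ (Fin n)))
    (u : EuclideanSpace ℝ (Fin n)) : Prop :=
  ‖u‖ = 1 ∧ ∀ x ∈ F, ∀ y ∈ P, inner ℝ u y ≤ inner ℝ u x

/-- Two subsets of Euclidean space are congruent if an isometry of the space carries one onto the
other. -/
def AreCongruent {n : ℕ} (P Q : Set (EuclideanSpace ℝ (Fin n))) : Prop :=
  ∃ g : EuclideanSpace ℝ (Fin n) ≃ᵢ EuclideanSpace ℝ (Fin n), g '' P = Q

/-! Up to the factor `n!`, the volume of the zonotope generated by the weighted vectors `x i • v i`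
is the polynomial `mixedDet e v x n 0` in `x`, whose coefficients are absolute determinants. The
theorem is Minkowski's uniqueness theorem for such polynomials, and the isometry found is a
translation.

Facet data give gradients. The face lattice isomorphism makes facet volumes agree in every direction
(`faceDet_eq_of_orderIso`). Cauchy's formula (`two_mul_mixedDet_cons`) writes `mixedDet e a 1 (n -
1) {w}`, which up to a constant is the volume of the projection along a unit vector `w`, as a sum
over facets, so these numbers agree too. Pool all generators into one family `v`, with 0-1 weights
`x` and `y` selecting the two zonotopes: the volume polynomial then has the same gradient at `x` and
at `y`.

Equal gradients force equality. The Hessian form is negative semidefinite on the complement of the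
positive weight vector (`mixedForm_nonpos`, an Alexandrov–Fenchel inequality proved by a
Bochner-type induction), so the `n`-th root of the volume is concave on the segment from `x` to `y`.
Equal gradients make the volume constant there (`deriv_eq_zero_of_rpow_concave`). The equality case,
descended one slot at a time, gives `∑ j, (y j - x j) * absDet e (v j ::ₘ t.map v) = 0` for every
`t` of size `n - 1` (`sum_sub_mul_absDet_eq_zero`).

Vanishing determinants give equal support functions. When `t` spans a hyperplane with normal `r`,
the identity says that `∑ i, d i * |inner ℝ (v i) r|` vanishes, where `d = y - x`. This function is
linear on each cone of the arrangement of hyperplanes orthogonal to the `v i`, and the cones are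
generated by such normals, so it vanishes identically (`sum_mul_abs_inner_eq_zero`). The support
functions then differ by a linear term, which is a translation (`image_add_zonotopeOf`). -/

section AbsDet

/-! ### Absolute determinants of multisets and the polarized volume polynomial. -/

variable {E : Type*} [AddCommGroup E] [Module ℝ E] {n : ℕ}

theorem exists_perm_of_map_univ_eq {α : Type*} {n : ℕ} {f g : Fin n → α}
    (h : Finset.univ.val.map f = Finset.univ.val.map g) :
    ∃ σ : Equiv.Perm (Fin n), f = g ∘ σ := by
  classical
  have key : ∀ c, Nonempty ({a // f a = c} ≃ {a // g a = c}) := by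
    intro c
    rw [← Fintype.card_eq, Fintype.card_subtype, Fintype.card_subtype]
    have h2 := congrArg (Multiset.count c) h
    simp only [Multiset.count_map] at h2
    simp only [Finset.card, Finset.filter_val]
    simpa only [eq_comm] using h2
  let e := fun c => (key c).some
  exact ⟨Equiv.ofFiberEquiv e, funext fun a => (Equiv.ofFiberEquiv_map e a).symm⟩

theorem map_univ_cons {α : Type*} {n : ℕ} (a : α) (f : Fin n → α) :
    Finset.univ.val.map (Fin.cons a f : Fin (n + 1) → α) = a ::ₘ Finset.univ.val.map f := by
  simp [Fin.univ_val_map]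

theorem exists_map_univ_eq {α : Type*} {n : ℕ} {s : Multiset α} (hs : s.card = n) :
    ∃ f : Fin n → α, Finset.univ.val.map f = s := by
  induction s using Multiset.induction_on generalizing n with
  | empty => subst hs; exact ⟨Fin.elim0, rfl⟩
  | cons a s ih =>
    subst hs
    obtain ⟨f, hf⟩ := ih rfl
    rw [Multiset.card_cons]
    exact ⟨Fin.cons a f, by rw [map_univ_cons, hf]⟩

/-- The absolute value of the determinant, with respect to the basis `e`, of a multiset of `n`
vectors; it is zero on multisets of any other size. -/
noncomputable def absDet (e : Module.Basis (Fin n) ℝ E) (s : Multiset E) : ℝ :=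
  open Classical in
  if h : ∃ f : Fin n → E, Finset.univ.val.map f = s then |e.det h.choose| else 0

variable (e : Module.Basis (Fin n) ℝ E)

/-- The chosen ordering is immaterial: two orderings of one multiset differ by a permutation, which
changes the determinant only by a sign. -/
theorem absDet_map (f : Fin n → E) : absDet e (Finset.univ.val.map f) = |e.det f| := by
  have h : ∃ g : Fin n → E, Finset.univ.val.map g = Finset.univ.val.map f := ⟨f, rfl⟩
  rw [absDet, dif_pos h]
  obtain ⟨σ, hσ⟩ := exists_perm_of_map_univ_eq h.choose_spec
  rw [hσ, AlternatingMap.map_perm]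
  rcases Int.units_eq_one_or (Equiv.Perm.sign σ) with h | h <;> simp [h]

theorem absDet_of_card_ne {s : Multiset E} (hs : s.card ≠ n) : absDet e s = 0 := by
  rw [absDet, dif_neg]
  rintro ⟨f, rfl⟩
  exact hs (by simp)

theorem absDet_nonneg (s : Multiset E) : 0 ≤ absDet e s := by
  rw [absDet]; split_ifs <;> positivity

theorem absDet_pos_iff {s : Multiset E} (hs : s.card = n) :
    0 < absDet e s ↔ Submodule.span ℝ {p | p ∈ s} = ⊤ := by
  obtain ⟨f, rfl⟩ := exists_map_univ_eq hs
  have hr : {p | p ∈ Finset.univ.val.map f} = Set.range f := by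
    ext p; simp
  have hcard : Fintype.card (Fin n) = Module.finrank ℝ E := by
    rw [Module.finrank_eq_card_basis e]
  rw [absDet_map, abs_pos, hr]
  constructor
  · intro h
    exact ((e.is_basis_iff_det).2 (isUnit_iff_ne_zero.2 h)).2
  · intro h
    exact (e.is_basis_iff_det.1 ⟨linearIndependent_of_top_le_span_of_card_eq_finrank h.ge hcard,
      h⟩).ne_zero

theorem absDet_cons_add {p q : E} {s : Multiset E} (h : absDet e (q ::ₘ s) = 0) :
    absDet e ((p + q) ::ₘ s) = absDet e (p ::ₘ s) := by
  by_cases hs : s.card + 1 = n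
  · subst hs
    obtain ⟨f, hf⟩ := exists_map_univ_eq (s := s) rfl
    have h1 : ∀ p, absDet e (p ::ₘ s) = |e.det.curryLeft p f| := fun p => by
      have := absDet_map e (Fin.cons p f)
      rw [map_univ_cons, hf] at this
      exact this
    rw [h1, abs_eq_zero] at h
    rw [h1, h1, map_add, AlternatingMap.add_apply, h, add_zero]
  · have h0 : ∀ p, absDet e (p ::ₘ s) = 0 := fun p => absDet_of_card_ne e (by simpa using hs)
    rw [h0, h0]

theorem absDet_cons_smul (a : ℝ) (p : E) (s : Multiset E) :
    absDet e ((a • p) ::ₘ s) = |a| * absDet e (p ::ₘ s) := by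
  by_cases hs : s.card + 1 = n
  · subst hs
    obtain ⟨f, hf⟩ := exists_map_univ_eq (s := s) rfl
    have h1 : ∀ p, absDet e (p ::ₘ s) = |e.det.curryLeft p f| := fun p => by
      have := absDet_map e (Fin.cons p f)
      rw [map_univ_cons, hf] at this
      exact this
    rw [h1, h1, map_smul, AlternatingMap.smul_apply, smul_eq_mul, abs_mul]
  · have h0 : ∀ p, absDet e (p ::ₘ s) = 0 := fun p => absDet_of_card_ne e (by simpa using hs)
    rw [h0, h0, mul_zero]

/-- The polarized volume polynomial of the weighted vectors `x i • v i`: summing the determinant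
over all ways of choosing `k` of them in order and completing by `s`. -/
noncomputable def mixedDet {ι : Type*} [Fintype ι] (v : ι → E) (x : ι → ℝ) : ℕ → Multiset E → ℝ
  | 0, s => absDet e s
  | k + 1, s => ∑ i, x i * mixedDet v x k (v i ::ₘ s)

variable {ι : Type*} [Fintype ι] (v : ι → E) (x : ι → ℝ)

theorem mixedDet_nonneg (hx : ∀ i, 0 ≤ x i) (k : ℕ) (s : Multiset E) :
    0 ≤ mixedDet e v x k s := by
  induction k generalizing s with
  | zero => exact absDet_nonneg e s
  | succ k ih => exact Finset.sum_nonneg fun i _ => mul_nonneg (hx i) (ih _)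

theorem finrank_span_cons_le (p : E) (s : Multiset E) [FiniteDimensional ℝ E] :
    Module.finrank ℝ (Submodule.span ℝ {q | q ∈ p ::ₘ s}) ≤
      Module.finrank ℝ (Submodule.span ℝ {q | q ∈ s}) + 1 := by
  have : {q | q ∈ p ::ₘ s} = {p} ∪ {q | q ∈ s} := by ext; simp
  rw [this, Submodule.span_union]
  have h1 := Submodule.finrank_add_le_finrank_add_finrank (Submodule.span ℝ {p})
    (Submodule.span ℝ {q | q ∈ s})
  have h2 : Module.finrank ℝ (Submodule.span ℝ {p}) ≤ 1 := by
    simpa using finrank_span_le_card (R := ℝ) ({p} : Set E)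
  omega

theorem finrank_span_le_card' (s : Multiset E) [FiniteDimensional ℝ E] :
    Module.finrank ℝ (Submodule.span ℝ {q | q ∈ s}) ≤ s.card := by
  induction s using Multiset.induction_on with
  | empty => simp
  | cons p s ih => simpa using (finrank_span_cons_le p s).trans (by omega)

theorem lt_finrank_span_cons {p : E} {s : Multiset E} [FiniteDimensional ℝ E]
    (hp : p ∉ Submodule.span ℝ {q | q ∈ s}) :
    Module.finrank ℝ (Submodule.span ℝ {q | q ∈ s}) <
      Module.finrank ℝ (Submodule.span ℝ {q | q ∈ p ::ₘ s}) := by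
  apply Submodule.finrank_lt_finrank_of_lt
  refine lt_of_le_of_ne (Submodule.span_mono fun q hq => by simpa using Or.inr hq) fun h => hp ?_
  rw [h]
  exact Submodule.subset_span (by simp)

theorem exists_notMem_of_finrank_lt {κ : Type*} (v : κ → E) {W : Submodule ℝ E} [FiniteDimensional ℝ E]
    (hv : Submodule.span ℝ (Set.range v) = ⊤)
    (hW : Module.finrank ℝ W < Module.finrank ℝ E) : ∃ i, v i ∉ W := by
  by_contra! h
  have : Submodule.span ℝ (Set.range v) ≤ W := Submodule.span_le.2 (by rintro _ ⟨i, rfl⟩; exact h i)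
  rw [hv, top_le_iff] at this
  rw [this, finrank_top] at hW
  exact hW.false

/-- All summands are nonnegative, so positivity means that some `k` of the `v i` complete `s` to a
basis. Since the `v i` span, this is possible exactly when `s` is independent. -/
theorem mixedDet_pos_iff (hx : ∀ i, 0 < x i) (hv : Submodule.span ℝ (Set.range v) = ⊤)
    {k : ℕ} {s : Multiset E} (hs : s.card + k = n) :
    0 < mixedDet e v x k s ↔ Module.finrank ℝ (Submodule.span ℝ {q | q ∈ s}) = s.card := by
  have : FiniteDimensional ℝ E := e.finiteDimensional_of_finite
  have hn : Module.finrank ℝ E = n := by simp [Module.finrank_eq_card_basis e]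
  induction k generalizing s with
  | zero =>
    simp only [add_zero] at hs
    rw [mixedDet, absDet_pos_iff e hs, hs, ← hn]
    exact ⟨fun h => by rw [h, finrank_top], fun h => Submodule.eq_top_of_finrank_eq h⟩
  | succ k ih =>
    rw [mixedDet, Finset.sum_pos_iff_of_nonneg
      fun i _ => mul_nonneg (hx i).le (mixedDet_nonneg e v x (fun j => (hx j).le) _ _)]
    simp only [Finset.mem_univ, true_and, mul_pos_iff_of_pos_left (hx _)]
    have hs' : ∀ i, (v i ::ₘ s).card + k = n := fun i => by simp; omega
    simp only [ih (hs' _), Multiset.card_cons]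
    have hle := finrank_span_le_card' s
    constructor
    · rintro ⟨i, hi⟩
      have := finrank_span_cons_le (v i) s
      omega
    · intro h
      obtain ⟨i, hi⟩ := exists_notMem_of_finrank_lt v hv
        (W := Submodule.span ℝ {q | q ∈ s}) (by omega)
      have h1 := lt_finrank_span_cons hi
      have h2 := finrank_span_cons_le (v i) s
      exact ⟨i, by omega⟩

end AbsDet

/-! ### Hyperbolic quadratic forms. -/

section Hyperbolic

variable {ι : Type*} [Fintype ι]

/-- Let `H` be a symmetric matrix with nonnegative entries and `x > 0`. If `H` satisfies the
Bochner-type inequality `⟪d, H d⟫ ≤ ∑ xᵢ (H d)ᵢ² / (H x)ᵢ` and is irreducible on its support, then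
`H` is negative semidefinite on the orthogonal complement of `H x`. -/
theorem sum_mul_mul_nonpos_of_bochner {H : ι → ι → ℝ} {x r : ι → ℝ}
    (hsymm : ∀ i j, H i j = H j i) (hH : ∀ i j, 0 ≤ H i j) (hx : ∀ i, 0 < x i)
    (hr : ∀ i, r i = ∑ j, H i j * x j)
    (hB : ∀ d : ι → ℝ, ∑ i, d i * ∑ j, H i j * d j ≤ ∑ i, x i * ((∑ j, H i j * d j) ^ 2 / r i))
    (hconn : ∀ i j, 0 < r i → 0 < r j → 0 < H i j ∨ ∃ k, 0 < H i k ∧ 0 < H j k)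
    {d : ι → ℝ} (hd : ∑ i, r i * d i = 0) :
    ∑ i, d i * ∑ j, H i j * d j ≤ 0 := by
  classical
  have hr0 : ∀ i, 0 ≤ r i := fun i => by
    rw [hr]; exact Finset.sum_nonneg fun j _ => mul_nonneg (hH i j) (hx j).le
  have hrH : ∀ i, r i = 0 → ∀ j, H i j = 0 := by
    intro i hi j
    rw [hr, Finset.sum_eq_zero_iff_of_nonneg fun j _ => mul_nonneg (hH i j) (hx j).le] at hi
    exact (mul_eq_zero.1 (hi j (Finset.mem_univ _))).resolve_right (hx j).ne'
  -- With this rescaling the Bochner inequality at an eigenvector of `S` reads `τ ≤ τ ^ 2`. Where `r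
  -- i = 0`, division by zero gives `c i = 0`, consistent with the vanishing row of `H`.
  set c : ι → ℝ := fun i => √(x i / r i) with hc
  have hc2 : ∀ i, c i ^ 2 = x i / r i := fun i => Real.sq_sqrt (div_nonneg (hx i).le (hr0 i))
  have hc0 : ∀ i, 0 ≤ c i := fun i => Real.sqrt_nonneg _
  set S : Matrix ι ι ℝ := Matrix.of fun i j => c i * H i j * c j with hS
  have hSh : S.IsHermitian := by
    ext i j
    simp only [hS, Matrix.conjTranspose_apply, Matrix.of_apply, star_trivial, hsymm i j]
    ring
  set b := hSh.eigenvectorBasis with hb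
  set τ := hSh.eigenvalues with hτ
  have heig : ∀ k i, ∑ j, S i j * b k j = τ k * b k i := by
    intro k i
    have := congrFun (hSh.mulVec_eigenvectorBasis k) i
    simpa [Matrix.mulVec, dotProduct] using this
  have hnorm : ∀ k, ∑ i, b k i ^ 2 = 1 := by
    intro k
    have := b.orthonormal.1 k
    rw [EuclideanSpace.norm_eq, Real.sqrt_eq_one] at this
    simpa using this
  have heig' : ∀ k i, c i * ∑ j, H i j * (c j * b k j) = τ k * b k i := by
    intro k i
    rw [← heig, Finset.mul_sum]
    exact Finset.sum_congr rfl fun j _ => by simp only [hS, Matrix.of_apply]; ring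
  set y : ι → ℝ := fun i => r i / x i * (c i * d i) with hy
  have hcy : ∀ i, 0 < r i → c i * y i = d i := by
    intro i hi
    have h1 := (hx i).ne'
    have h2 := hi.ne'
    have : c i * y i = r i / x i * c i ^ 2 * d i := by simp only [hy]; ring
    rw [this, hc2]; field_simp
  have hquad : ∀ k, ∑ i, (c i * b k i) * ∑ j, H i j * (c j * b k j) = τ k := by
    intro k
    calc _ = ∑ i, τ k * b k i ^ 2 := Finset.sum_congr rfl fun i _ => by
            rw [mul_comm (c i), mul_assoc, heig']; ring
      _ = τ k := by rw [← Finset.mul_sum, hnorm, mul_one]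
  -- A positive eigenvalue is at least `1`, so the Dirichlet energy of `z` below, equal to `2 - 2 *
  -- τ k`, is at most `0`. Connectedness makes `z` constant on the support of `r`: the eigenvector
  -- is the Perron one, and `hd` says that `y` is orthogonal to it.
  have hpos : ∀ k, 0 < τ k → ∑ i, b k i * y i = 0 := by
    intro k hk
    have h1 : 1 ≤ τ k := by
      have h := hB fun i => c i * b k i
      rw [hquad] at h
      have h2 : ∑ i, x i * ((∑ j, H i j * (c j * b k j)) ^ 2 / r i) = τ k ^ 2 := by
        calc _ = ∑ i, (τ k * b k i) ^ 2 := Finset.sum_congr rfl fun i _ => by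
              rw [← heig', mul_pow, hc2]; ring
          _ = _ := by simp_rw [mul_pow]; rw [← Finset.mul_sum, hnorm, mul_one]
      rw [h2] at h
      nlinarith
    have hb0 : ∀ i, r i = 0 → b k i = 0 := by
      intro i hi
      have := heig' k i
      have h0 : c i = 0 := by simp [hc, hi]
      rw [h0, zero_mul] at this
      exact (mul_eq_zero.1 this.symm).resolve_left hk.ne'
    set z : ι → ℝ := fun i => c i * b k i / x i with hz
    have hzx : ∀ i, x i * z i = c i * b k i := fun i => mul_div_cancel₀ _ (hx i).ne'
    have hsum : ∑ i, ∑ j, H i j * x i * x j * (z i - z j) ^ 2 ≤ 0 := by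
      have e1 : ∑ i, ∑ j, H i j * x i * x j * z i ^ 2 = 1 := by
        rw [← hnorm k]
        refine Finset.sum_congr rfl fun i _ => ?_
        have : ∑ j, H i j * x i * x j * z i ^ 2 = x i * z i ^ 2 * r i := by
          rw [hr, Finset.mul_sum]
          exact Finset.sum_congr rfl fun j _ => by ring
        rw [this]
        rcases (hr0 i).eq_or_lt with h | h
        · rw [← h, hb0 i h.symm]; ring
        · have : x i * z i ^ 2 * r i = c i ^ 2 * b k i ^ 2 * r i / x i := by
            simp only [hz]; have := (hx i).ne'; field_simp
          rw [this, hc2]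
          have := (hx i).ne'
          have := h.ne'
          field_simp
      have e2 : ∑ i, ∑ j, H i j * x i * x j * z j ^ 2 = 1 := by
        rw [Finset.sum_comm, ← e1]
        exact Finset.sum_congr rfl fun i _ => Finset.sum_congr rfl fun j _ => by
          rw [hsymm]; ring
      have e3 : ∑ i, ∑ j, H i j * x i * x j * (z i * z j) = τ k := by
        rw [← hquad k]
        refine Finset.sum_congr rfl fun i _ => ?_
        rw [Finset.mul_sum]
        exact Finset.sum_congr rfl fun j _ => by rw [← hzx, ← hzx]; ring
      calc _ = ∑ i, ∑ j, H i j * x i * x j * z i ^ 2 + ∑ i, ∑ j, H i j * x i * x j * z j ^ 2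
            - 2 * ∑ i, ∑ j, H i j * x i * x j * (z i * z j) := by
            simp only [Finset.mul_sum, ← Finset.sum_add_distrib, ← Finset.sum_sub_distrib]
            exact Finset.sum_congr rfl fun i _ => Finset.sum_congr rfl fun j _ => by ring
        _ ≤ 0 := by rw [e1, e2, e3]; linarith
    have hnn : ∀ i j, 0 ≤ H i j * x i * x j * (z i - z j) ^ 2 := fun i j =>
      mul_nonneg (mul_nonneg (mul_nonneg (hH i j) (hx i).le) (hx j).le) (sq_nonneg _)
    have hadj : ∀ i j, 0 < H i j → z i = z j := by
      intro i j hij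
      have h0 := le_antisymm hsum
        (Finset.sum_nonneg fun i _ => Finset.sum_nonneg fun j _ => hnn i j)
      rw [Finset.sum_eq_zero_iff_of_nonneg
        fun i _ => Finset.sum_nonneg fun j _ => hnn i j] at h0
      have h0 := (Finset.sum_eq_zero_iff_of_nonneg fun j _ => hnn i j).1
        (h0 i (Finset.mem_univ _)) j (Finset.mem_univ _)
      have h3 := mul_pos (mul_pos hij (hx i)) (hx j)
      exact sub_eq_zero.1 (pow_eq_zero_iff (two_ne_zero) |>.1
        ((mul_eq_zero.1 h0).resolve_left h3.ne'))
    have hall : ∀ i j, 0 < r i → 0 < r j → z i = z j := by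
      intro i j hi hj
      rcases hconn i j hi hj with h | ⟨m, h1, h2⟩
      · exact hadj i j h
      · rw [hadj i m h1, hadj j m h2]
    obtain ⟨w, hw⟩ : ∃ w, ∀ i, 0 < r i → z i = w := by
      by_cases h : ∃ i, 0 < r i
      · obtain ⟨i, hi⟩ := h
        exact ⟨z i, fun j hj => hall j i hj hi⟩
      · exact ⟨0, fun i hi => (h ⟨i, hi⟩).elim⟩
    calc ∑ i, b k i * y i = ∑ i, w * (r i * d i) := Finset.sum_congr rfl fun i _ => by
          rcases (hr0 i).eq_or_lt with h | h
          · simp [hy, ← h]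
          · rw [← hw i h]; simp only [hy, hz]; ring
      _ = 0 := by rw [← Finset.mul_sum, hd, mul_zero]
  have hexp : ∑ i, d i * ∑ j, H i j * d j = ∑ k, τ k * (∑ i, b k i * y i) ^ 2 := by
    have h1 : ∑ i, d i * ∑ j, H i j * d j = ∑ i, y i * ∑ j, S i j * y j := by
      refine Finset.sum_congr rfl fun i _ => ?_
      rw [Finset.mul_sum, Finset.mul_sum]
      refine Finset.sum_congr rfl fun j _ => ?_
      rcases (hr0 i).eq_or_lt with h | h
      · simp [hS, hrH i h.symm j]
      rcases (hr0 j).eq_or_lt with h' | h'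
      · simp [hS, hsymm i j, hrH j h'.symm i]
      · rw [← hcy i h, ← hcy j h']; simp only [hS, Matrix.of_apply]; ring
    have h2 := b.sum_inner_mul_inner (WithLp.toLp 2 y) (WithLp.toLp 2 fun i => ∑ j, S i j * y j)
    simp only [PiLp.inner_apply, RCLike.inner_apply, conj_trivial] at h2
    have h3 : ∀ k, ∑ i, (∑ j, S i j * y j) * b k i = τ k * ∑ i, b k i * y i := by
      intro k
      simp only [Finset.sum_mul, Finset.mul_sum]
      rw [Finset.sum_comm]
      refine Finset.sum_congr rfl fun j _ => ?_
      rw [← mul_assoc, ← heig k j, Finset.sum_mul]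
      refine Finset.sum_congr rfl fun i _ => ?_
      simp only [hS, Matrix.of_apply, hsymm i j]; ring
    rw [h1]
    calc _ = ∑ i, (∑ j, S i j * y j) * y i := Finset.sum_congr rfl fun i _ => mul_comm _ _
      _ = _ := by
        rw [← h2]
        refine Finset.sum_congr rfl fun k _ => ?_
        rw [h3]; ring
  rw [hexp]
  refine Finset.sum_nonpos fun k _ => ?_
  rcases le_or_gt (τ k) 0 with h | h
  · exact mul_nonpos_of_nonpos_of_nonneg h (sq_nonneg _)
  · rw [hpos k h]; simp

/-- A symmetric form that is negative semidefinite on a hyperplane is negative semidefinite on the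
orthogonal complement of any vector on which it is positive. -/
theorem nonpos_of_nonpos_on_ker {V : Type*} [AddCommGroup V] [Module ℝ V]
    (Q : V →ₗ[ℝ] V →ₗ[ℝ] ℝ) (hQ : ∀ a b, Q a b = Q b a) (φ : V →ₗ[ℝ] ℝ)
    (hφ : ∀ d, φ d = 0 → Q d d ≤ 0) {x d : V} (hx : 0 < Q x x) (hxd : Q x d = 0) : Q d d ≤ 0 := by
  -- This combination of `x` and `d` is chosen to lie in the kernel of `φ`.
  have h := hφ (φ d • x - φ x • d) (by simp; ring)
  simp only [map_sub, map_smul, LinearMap.sub_apply, LinearMap.smul_apply, smul_eq_mul, hQ d x,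
    hxd] at h
  by_cases h0 : φ x = 0
  · exact absurd (hφ x h0) hx.not_ge
  · have : 0 < φ x ^ 2 := by positivity
    by_contra! hd
    nlinarith [mul_nonneg (sq_nonneg (φ d)) hx.le, mul_pos this hd]

/-- Equality case of a reverse Cauchy–Schwarz inequality. -/
theorem eq_zero_of_nonpos_on_compl {V : Type*} [AddCommGroup V] [Module ℝ V]
    (Q : V →ₗ[ℝ] V →ₗ[ℝ] ℝ) (hQ : ∀ a b, Q a b = Q b a) {x d : V} (hx : 0 < Q x x)
    (hneg : ∀ a, Q x a = 0 → Q a a ≤ 0) (hxd : Q x d = 0) (hd : Q d d = 0) (a : V) :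
    Q d a = 0 := by
  set a' := a - (Q x a / Q x x) • x with ha'
  have hxa' : Q x a' = 0 := by
    simp [ha', hx.ne']
  have hda' : Q d a' = Q d a := by simp [ha', hQ d x, hxd]
  rw [← hda']
  have key : ∀ t : ℝ, 2 * t * Q d a' + t ^ 2 * Q a' a' ≤ 0 := by
    intro t
    have := hneg (d + t • a') (by simp [hxd, hxa'])
    simp only [map_add, map_smul, LinearMap.add_apply, LinearMap.smul_apply, smul_eq_mul, hd,
      hQ a' d] at this
    linarith
  have hn := hneg a' hxa'
  by_contra hne
  have h2 : 0 < Q d a' ^ 2 := by positivity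
  -- The optimal `t` would divide by `-Q a' a'`, which may be zero; adding `1` keeps the denominator
  -- positive, and the linear term still dominates.
  have h3 := key (Q d a' / (1 - Q a' a'))
  have h4 : 0 < 1 - Q a' a' := by linarith
  have h5 : 2 * (Q d a' / (1 - Q a' a')) * Q d a' + (Q d a' / (1 - Q a' a')) ^ 2 * Q a' a' =
      Q d a' ^ 2 * (2 - Q a' a') / (1 - Q a' a') ^ 2 := by
    field_simp; ring
  rw [h5] at h3
  have : 0 < Q d a' ^ 2 * (2 - Q a' a') / (1 - Q a' a') ^ 2 := by
    have : 0 < 2 - Q a' a' := by linarith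
    positivity
  linarith

/-- The distance on the real line is conditionally negative definite. -/
theorem sum_mul_mul_abs_sub_nonpos (d s : ι → ℝ) (hd : ∑ i, d i = 0) :
    ∑ i, ∑ j, d i * d j * |s i - s j| ≤ 0 := by
  classical
  -- After a shift by `R`, `min (s i) (s j)` is the Gram matrix of the indicators of `(-R, s i]`,
  -- and `|s i - s j|` is `s i + s j - 2 * min (s i) (s j)`.
  set R := ∑ i, |s i| with hR
  have hsR : ∀ i, |s i| ≤ R := fun i =>
    Finset.single_le_sum (f := fun i => |s i|) (fun j _ => abs_nonneg _) (Finset.mem_univ i)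
  let χ : ι → ℝ → ℝ := fun i => Set.indicator (Set.Ioc (-R) (s i)) 1
  have hχi : ∀ i, MeasureTheory.Integrable (χ i) := fun i =>
    (MeasureTheory.integrable_indicator_iff measurableSet_Ioc).2
      (MeasureTheory.integrableOn_const (C := (1 : ℝ)) (by simp))
  have hχχ : ∀ i j, (fun t => χ i t * χ j t) =
      Set.indicator (Set.Ioc (-R) (min (s i) (s j))) 1 := by
    intro i j
    ext t
    simp only [χ, Set.indicator_apply, Set.mem_Ioc, le_min_iff, Pi.one_apply]
    by_cases h1 : -R < t <;> by_cases h2 : t ≤ s i <;> by_cases h3 : t ≤ s j <;> simp [h1, h2, h3]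
  have hχχi : ∀ i j, MeasureTheory.Integrable (fun t => χ i t * χ j t) := fun i j => by
    rw [hχχ]
    exact (MeasureTheory.integrable_indicator_iff measurableSet_Ioc).2
      (MeasureTheory.integrableOn_const (C := (1 : ℝ)) (by simp))
  have hint : ∀ i j, ∫ t, χ i t * χ j t = min (s i) (s j) + R := by
    intro i j
    rw [hχχ, MeasureTheory.integral_indicator_one measurableSet_Ioc]
    have h1 := (abs_le.1 (hsR i)).1
    have h2 := (abs_le.1 (hsR j)).1
    have := le_min h1 h2
    rw [Real.volume_real_Ioc_of_le this]; ring
  have hmin : 0 ≤ ∑ i, ∑ j, d i * d j * (min (s i) (s j) + R) := by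
    have h1 : 0 ≤ ∫ t, (∑ i, d i * χ i t) ^ 2 :=
      MeasureTheory.integral_nonneg fun t => sq_nonneg _
    have h2 : ∀ t, (∑ i, d i * χ i t) ^ 2 = ∑ i, ∑ j, d i * d j * (χ i t * χ j t) := by
      intro t
      rw [sq, Finset.sum_mul_sum]
      exact Finset.sum_congr rfl fun i _ => Finset.sum_congr rfl fun j _ => by ring
    simp_rw [h2] at h1
    rw [MeasureTheory.integral_finsetSum _ fun i _ => MeasureTheory.integrable_finsetSum _
      fun j _ => (hχχi i j).const_mul _] at h1
    simp_rw [MeasureTheory.integral_finsetSum _ fun j _ => (hχχi _ j).const_mul _,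
      MeasureTheory.integral_const_mul, hint] at h1
    exact h1
  have e1 : ∑ i, ∑ j, d i * d j * s i = 0 := by
    simp_rw [mul_right_comm _ _ (s _), ← Finset.mul_sum, hd, mul_zero, Finset.sum_const_zero]
  have e2 : ∑ i, ∑ j, d i * d j * s j = 0 := by
    rw [Finset.sum_comm, ← e1]
    exact Finset.sum_congr rfl fun i _ => Finset.sum_congr rfl fun j _ => by ring
  have e3 : ∑ i, ∑ j, d i * d j * R = 0 := by
    simp_rw [mul_right_comm _ _ R, ← Finset.mul_sum, hd, mul_zero, Finset.sum_const_zero]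
  have e4 : ∑ i, ∑ j, d i * d j * |s i - s j| =
      ∑ i, ∑ j, d i * d j * s i + ∑ i, ∑ j, d i * d j * s j
      + 2 * ∑ i, ∑ j, d i * d j * R
      - 2 * ∑ i, ∑ j, d i * d j * (min (s i) (s j) + R) := by
    simp only [Finset.mul_sum, ← Finset.sum_add_distrib, ← Finset.sum_sub_distrib]
    refine Finset.sum_congr rfl fun i _ => Finset.sum_congr rfl fun j _ => ?_
    rcases le_total (s i) (s j) with h | h
    · rw [min_eq_left h, abs_of_nonpos (by linarith)]; ring
    · rw [min_eq_right h, abs_of_nonneg (by linarith)]; ring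
  rw [e4, e1, e2, e3]
  linarith

/-- The form `∑ dᵢ dⱼ |αᵢ βⱼ - αⱼ βᵢ|` is negative semidefinite on the hyperplane
`∑ dᵢ |αᵢ| = 0`. -/
theorem sum_mul_mul_abs_det_nonpos (α β d : ι → ℝ) (hd : ∑ i, d i * |α i| = 0) :
    ∑ i, ∑ j, d i * d j * |α i * β j - α j * β i| ≤ 0 := by
  classical
  have h1 := sum_mul_mul_abs_sub_nonpos (fun i => d i * |α i|) (fun i => β i / α i) hd
  let ε : ι → ℝ := fun i => if α i = 0 then d i * |β i| else 0
  -- Dividing by `α` turns the planar determinant into a distance of slopes. Indices with `α i = 0`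
  -- contribute only through `ε`, in products whose other factor sums to zero by `hd`.
  have key : ∀ i j, d i * d j * |α i * β j - α j * β i| =
      (d i * |α i|) * (d j * |α j|) * |β i / α i - β j / α j| + ε i * (d j * |α j|)
        + (d i * |α i|) * ε j := by
    intro i j
    by_cases hi : α i = 0 <;> by_cases hj : α j = 0
    · simp [ε, hi, hj]
    · simp [ε, hi, hj, abs_mul]; ring
    · simp [ε, hi, hj, abs_mul]; ring
    · simp only [ε, hi, hj, if_false]
      have : α i * β j - α j * β i = - (α i * α j * (β i / α i - β j / α j)) := by
        field_simp; ring
      rw [this, abs_neg, abs_mul, abs_mul]; ring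
  simp_rw [key, Finset.sum_add_distrib, ← Finset.mul_sum, ← Finset.sum_mul, hd]
  simpa using h1

end Hyperbolic

/-! ### The Alexandrov–Fenchel inequality and its equality case. -/

section MixedForm

variable {E : Type*} [AddCommGroup E] [Module ℝ E] {n : ℕ} (e : Module.Basis (Fin n) ℝ E)

/-- With `n - 2` vectors fixed, the determinant is an alternating form in two variables that kills
the span of `s`. It therefore lives on a quotient of dimension two, where it is a multiple of the
area form. This starts the induction in `mixedForm_nonpos`. -/
theorem exists_absDet_cons_cons {s : Multiset E} (hs : s.card + 2 = n) :
    ∃ α β : E →ₗ[ℝ] ℝ, ∀ p q, absDet e (p ::ₘ q ::ₘ s) = |α p * β q - α q * β p| := by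
  subst hs
  obtain ⟨f, hf⟩ := exists_map_univ_eq (s := s) rfl
  let D : E → E → ℝ := fun p q => (e.det.curryLeft p).curryLeft q f
  have hD : ∀ p q, absDet e (p ::ₘ q ::ₘ s) = |D p q| := by
    intro p q
    have h1 := absDet_map e (Fin.cons p (Fin.cons q f))
    rw [map_univ_cons, map_univ_cons, hf] at h1
    exact h1
  have hadd : ∀ p p' q, D (p + p') q = D p q + D p' q := fun p p' q => by
    simp only [D, map_add, AlternatingMap.curryLeft_add, LinearMap.add_apply,
      AlternatingMap.add_apply]
  have hsmul : ∀ (r : ℝ) p q, D (r • p) q = r * D p q := fun r p q => by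
    simp only [D, map_smul, AlternatingMap.curryLeft_smul, LinearMap.smul_apply,
      AlternatingMap.smul_apply, smul_eq_mul]
  have hself : ∀ p, D p p = 0 := fun p =>
    e.det.map_eq_zero_of_eq (Fin.cons p (Fin.cons p f)) (i := 0) (j := 1) rfl (by simp)
  have hadd' : ∀ p q q', D p (q + q') = D p q + D p q' := fun p q q' => by
    simp only [D, map_add, AlternatingMap.add_apply]
  have hsmul' : ∀ (r : ℝ) p q, D p (r • q) = r * D p q := fun r p q => by
    simp only [D, map_smul, AlternatingMap.smul_apply, smul_eq_mul]
  have hanti : ∀ p q, D p q = - D q p := fun p q => by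
    have := hself (p + q)
    rw [hadd, hadd', hadd', hself, hself] at this
    linarith
  have hspan : ∀ p ∈ Submodule.span ℝ (Set.range f), ∀ q, D p q = 0 := by
    intro p hp q
    induction hp using Submodule.span_induction with
    | mem p hp =>
      obtain ⟨i, rfl⟩ := hp
      exact e.det.map_eq_zero_of_eq (Fin.cons (f i) (Fin.cons q f)) (i := 0) (j := i.succ.succ)
        (by simp) (Fin.succ_ne_zero _).symm
    | zero => simpa using hsmul 0 0 q
    | add a b _ _ ha hb => rw [hadd, ha, hb, add_zero]
    | smul r a _ ha => rw [hsmul, ha, mul_zero]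
  have hspan' : ∀ p ∈ Submodule.span ℝ (Set.range f), ∀ q, D q p = 0 := fun p hp q => by
    rw [hanti, hspan p hp, neg_zero]
  by_cases h0 : ∀ p q, D p q = 0
  · exact ⟨0, 0, fun p q => by simp [hD, h0]⟩
  push Not at h0
  obtain ⟨p₀, q₀, hc⟩ := h0
  have htop : Submodule.span ℝ (insert p₀ (insert q₀ (Set.range f))) = ⊤ := by
    have h1 := (e.is_basis_iff_det.2 (isUnit_iff_ne_zero.2 (show
      e.det (Fin.cons p₀ (Fin.cons q₀ f)) ≠ 0 from hc))).2
    rwa [Fin.range_cons, Fin.range_cons] at h1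
  have hdecomp : ∀ p, ∃ a b : ℝ, ∃ w ∈ Submodule.span ℝ (Set.range f),
      p = a • p₀ + (b • q₀ + w) := by
    intro p
    have hp : p ∈ Submodule.span ℝ (insert p₀ (insert q₀ (Set.range f))) := htop ▸ trivial
    obtain ⟨a, z, hz, rfl⟩ := Submodule.mem_span_insert.1 hp
    obtain ⟨b, w, hw, rfl⟩ := Submodule.mem_span_insert.1 hz
    exact ⟨a, b, w, hw, rfl⟩
  refine ⟨{ toFun := fun p => D p q₀, map_add' := fun p p' => hadd p p' q₀,
            map_smul' := fun r p => hsmul r p q₀ },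
          { toFun := fun p => D p₀ p / D p₀ q₀
            map_add' := fun p p' => by rw [hadd', add_div]
            map_smul' := fun r p => by rw [hsmul', RingHom.id_apply, smul_eq_mul, mul_div_assoc] },
    fun p q => ?_⟩
  obtain ⟨a, b, w, hw, rfl⟩ := hdecomp p
  obtain ⟨a', b', w', hw', rfl⟩ := hdecomp q
  simp only [hD, LinearMap.coe_mk, AddHom.coe_mk]
  congr 1
  simp only [hadd, hadd', hsmul, hsmul', hself, hspan w hw, hspan w' hw', hspan' w hw,
    hspan' w' hw', hanti q₀ p₀]
  field_simp
  ring

variable {ι : Type*} [Fintype ι] (v : ι → E) (x : ι → ℝ)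

/-- The symmetric bilinear form obtained from the polarized volume polynomial by completing the
multiset `s` with two of the vectors `v i`. -/
noncomputable def mixedForm [DecidableEq ι] (k : ℕ) (s : Multiset E) :
    (ι → ℝ) →ₗ[ℝ] (ι → ℝ) →ₗ[ℝ] ℝ :=
  Matrix.toLinearMap₂' ℝ (Matrix.of fun i j => mixedDet e v x k (v i ::ₘ v j ::ₘ s))

variable [DecidableEq ι] {v x}

theorem mixedForm_apply (k : ℕ) (s : Multiset E) (d d' : ι → ℝ) :
    mixedForm e v x k s d d' =
      ∑ i, d i * ∑ j, mixedDet e v x k (v i ::ₘ v j ::ₘ s) * d' j := by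
  simp [mixedForm, Matrix.toLinearMap₂'_apply', dotProduct, Matrix.mulVec]

theorem mixedForm_comm (k : ℕ) (s : Multiset E) (d d' : ι → ℝ) :
    mixedForm e v x k s d d' = mixedForm e v x k s d' d := by
  simp only [mixedForm_apply, Finset.mul_sum]
  rw [Finset.sum_comm]
  exact Finset.sum_congr rfl fun i _ => Finset.sum_congr rfl fun j _ => by
    rw [Multiset.cons_swap]; ring

theorem mixedForm_self_left (k : ℕ) (s : Multiset E) (d : ι → ℝ) :
    mixedForm e v x k s x d = ∑ j, mixedDet e v x (k + 1) (v j ::ₘ s) * d j := by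
  simp only [mixedForm_apply, mixedDet, Finset.mul_sum, Finset.sum_mul]
  rw [Finset.sum_comm]
  exact Finset.sum_congr rfl fun i _ => Finset.sum_congr rfl fun j _ => by ring

theorem mixedForm_self_self (k : ℕ) (s : Multiset E) :
    mixedForm e v x k s x x = mixedDet e v x (k + 2) s := by
  rw [mixedForm_self_left, mixedDet]
  exact Finset.sum_congr rfl fun i _ => mul_comm _ _

/-- Expanding one weighted slot expresses the form through forms with one more fixed vector, the
step on which both inductions below rest. -/
theorem mixedForm_succ (k : ℕ) (s : Multiset E) (d d' : ι → ℝ) :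
    mixedForm e v x (k + 1) s d d' = ∑ m, x m * mixedForm e v x k (v m ::ₘ s) d d' := by
  simp only [mixedForm_apply, mixedDet, Finset.mul_sum, Finset.sum_mul]
  rw [Finset.sum_comm' (t' := Finset.univ) (s' := fun _ => Finset.univ) (by simp)]
  conv_rhs => rw [Finset.sum_comm]
  rw [Finset.sum_comm]
  refine Finset.sum_congr rfl fun i _ => ?_
  rw [Finset.sum_comm]
  refine Finset.sum_congr rfl fun m _ => Finset.sum_congr rfl fun j _ => ?_
  have : v m ::ₘ v i ::ₘ v j ::ₘ s = v i ::ₘ v j ::ₘ v m ::ₘ s := by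
    rw [Multiset.cons_swap, Multiset.cons_swap (v m)]
  rw [this]; ring

theorem mixedForm_single_right (k : ℕ) (s : Multiset E) (d : ι → ℝ) (i : ι) :
    mixedForm e v x k s d (Pi.single i 1) = ∑ j, d j * mixedDet e v x k (v j ::ₘ v i ::ₘ s) := by
  simp [mixedForm_apply, Pi.single_apply]

theorem mixedForm_eq_zero (hx : ∀ i, 0 < x i) {k : ℕ} {s : Multiset E}
    (h : mixedDet e v x (k + 2) s = 0) : mixedForm e v x k s = 0 := by
  have hx' := fun i => (hx i).le
  have h0 : ∀ i j, mixedDet e v x k (v i ::ₘ v j ::ₘ s) = 0 := by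
    intro i j
    rw [mixedDet, Finset.sum_eq_zero_iff_of_nonneg
      fun j _ => mul_nonneg (hx' j) (mixedDet_nonneg e v x hx' _ _)] at h
    have h1 := (mul_eq_zero.1 (h j (Finset.mem_univ _))).resolve_left (hx j).ne'
    rw [mixedDet, Finset.sum_eq_zero_iff_of_nonneg
      fun j _ => mul_nonneg (hx' j) (mixedDet_nonneg e v x hx' _ _)] at h1
    exact (mul_eq_zero.1 (h1 i (Finset.mem_univ _))).resolve_left (hx i).ne'
  refine LinearMap.ext fun a => LinearMap.ext fun b => ?_
  simp [mixedForm_apply, h0]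

/-- The Alexandrov–Fenchel inequality for zonotopes, with all but two of the free arguments
equal. -/
theorem mixedForm_nonpos (hx : ∀ i, 0 < x i) (hv : Submodule.span ℝ (Set.range v) = ⊤)
    {k : ℕ} {s : Multiset E} (hs : s.card + k + 2 = n) {d : ι → ℝ}
    (hd : mixedForm e v x k s x d = 0) : mixedForm e v x k s d d ≤ 0 := by
  have hx' := fun i => (hx i).le
  have hfin : FiniteDimensional ℝ E := e.finiteDimensional_of_finite
  have hnE : Module.finrank ℝ E = n := by simp [Module.finrank_eq_card_basis e]
  induction k generalizing s d with
  | zero =>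
    rcases (mixedDet_nonneg e v x hx' 2 s).eq_or_lt with h0 | h0
    · rw [mixedForm_eq_zero e hx h0.symm]; simp
    obtain ⟨α, β, hαβ⟩ := exists_absDet_cons_cons e (s := s) (by omega)
    -- The planar kernel is controlled on the hyperplane `∑ i, |α (v i)| * d i = 0`; this is moved
    -- to the complement of `x`, on which the form is positive.
    refine nonpos_of_nonpos_on_ker _ (mixedForm_comm e 0 s)
      (∑ i, |α (v i)| • LinearMap.proj i) (fun d hd => ?_) (by rwa [mixedForm_self_self]) hd
    have := sum_mul_mul_abs_det_nonpos (fun i => α (v i)) (fun i => β (v i)) d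
      (by simpa [mul_comm] using hd)
    rw [mixedForm_apply]
    refine le_of_eq_of_le (Finset.sum_congr rfl fun i _ => ?_) this
    rw [Finset.mul_sum]
    refine Finset.sum_congr rfl fun j _ => ?_
    rw [mixedDet, hαβ]; ring
  | succ k ih =>
    have hrpos : ∀ i, 0 < mixedDet e v x (k + 2) (v i ::ₘ s) ↔
        Module.finrank ℝ (Submodule.span ℝ {q | q ∈ v i ::ₘ s}) = s.card + 1 := fun i => by
      rw [mixedDet_pos_iff e v x hx hv (by simp; omega), Multiset.card_cons]
    rw [mixedForm_apply]
    refine sum_mul_mul_nonpos_of_bochner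
      (r := fun i => mixedDet e v x (k + 2) (v i ::ₘ s))
      (fun i j => by rw [Multiset.cons_swap])
      (fun i j => mixedDet_nonneg e v x hx' _ _) hx (fun i => ?_) (fun d => ?_)
      (fun i j hi hj => ?_) ?_
    · rw [mixedDet]
      exact Finset.sum_congr rfl fun j _ => by rw [Multiset.cons_swap, mul_comm]
    -- The Bochner inequality is the weighted sum over `i` of the inductive reverse Cauchy–Schwarz
    -- inequalities for the forms `Q` with `v i` fixed.
    · rw [← mixedForm_apply, mixedForm_succ]
      refine Finset.sum_le_sum fun i _ => mul_le_mul_of_nonneg_left ?_ (hx' i)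
      set Q := mixedForm e v x k (v i ::ₘ s) with hQ
      have hsum : ∑ j, mixedDet e v x (k + 1) (v i ::ₘ v j ::ₘ s) * d j = Q x d := by
        rw [hQ, mixedForm_self_left]
        exact Finset.sum_congr rfl fun j _ => by rw [Multiset.cons_swap]
      rw [hsum, ← mixedForm_self_self, ← hQ]
      rcases (mixedDet_nonneg e v x hx' (k + 2) (v i ::ₘ s)).eq_or_lt with h0 | h0
      · rw [hQ, mixedForm_eq_zero e hx h0.symm]; simp
      · rw [← mixedForm_self_self, ← hQ] at h0
        have h1 : Q x (d - (Q x d / Q x x) • x) = 0 := by simp [h0.ne']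
        have h2 := ih (s := v i ::ₘ s) (by simp; omega) h1
        rw [← hQ] at h2
        simp only [map_sub, map_smul, LinearMap.sub_apply, LinearMap.smul_apply, smul_eq_mul,
          hQ, mixedForm_comm e k (v i ::ₘ s) d x] at h2
        simp only [← hQ] at h2
        have h3 : Q x d ^ 2 / Q x x = Q x d / Q x x * Q x d := by ring
        have h4 : Q x d / Q x x * Q x x = Q x d := div_mul_cancel₀ _ h0.ne'
        rw [h4] at h2
        linarith
    · rw [hrpos] at hi hj
      have hpos : ∀ a b, v b ∉ Submodule.span ℝ {q | q ∈ v a ::ₘ s} →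
          Module.finrank ℝ (Submodule.span ℝ {q | q ∈ v a ::ₘ s}) = s.card + 1 →
          0 < mixedDet e v x (k + 1) (v a ::ₘ v b ::ₘ s) := by
        intro a b hb ha
        rw [Multiset.cons_swap, mixedDet_pos_iff e v x hx hv (by simp; omega)]
        have h1 := lt_finrank_span_cons hb
        have h2 := finrank_span_cons_le (v b) (v a ::ₘ s)
        simp only [Multiset.card_cons]
        omega
      -- If `v i` and `v j` are parallel modulo the span of `s`, they are not adjacent, but any `v
      -- m` outside the common span is adjacent to both.
      by_cases hmem : v j ∈ Submodule.span ℝ {q | q ∈ v i ::ₘ s}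
      · right
        have hle : Submodule.span ℝ {q | q ∈ v j ::ₘ s} ≤ Submodule.span ℝ {q | q ∈ v i ::ₘ s} := by
          rw [Submodule.span_le]
          intro q hq
          rcases Multiset.mem_cons.1 hq with rfl | hq
          · exact hmem
          · exact Submodule.subset_span (Multiset.mem_cons_of_mem hq)
        have heq := Submodule.eq_of_le_of_finrank_eq hle (hj.trans hi.symm)
        obtain ⟨m, hm⟩ := exists_notMem_of_finrank_lt v hv
          (W := Submodule.span ℝ {q | q ∈ v i ::ₘ s}) (by omega)
        exact ⟨m, hpos i m hm hi, hpos j m (heq ▸ hm) hj⟩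
      · exact Or.inl (hpos i j hmem hi)
    · rwa [mixedForm_self_left] at hd

/-- The equality case of `mixedForm_nonpos`. -/
theorem mixedForm_eq_zero_of_eq_zero (hx : ∀ i, 0 < x i)
    (hv : Submodule.span ℝ (Set.range v) = ⊤) {k : ℕ} {s : Multiset E}
    (hs : s.card + k + 2 = n) {d : ι → ℝ} (hd : mixedForm e v x k s x d = 0)
    (hdd : mixedForm e v x k s d d = 0) (a : ι → ℝ) : mixedForm e v x k s d a = 0 := by
  rcases (mixedDet_nonneg e v x (fun i => (hx i).le) (k + 2) s).eq_or_lt with h0 | h0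
  · rw [mixedForm_eq_zero e hx h0.symm]; simp
  · exact eq_zero_of_nonpos_on_compl _ (mixedForm_comm e k s)
      (by rwa [mixedForm_self_self]) (fun a ha => mixedForm_nonpos e hx hv hs ha) hd hdd a

/-- If `d` is in the kernel of the form, then it is orthogonal to `x` for each form with `v m`
fixed. Those forms are nonpositive at `d` and have weighted sum zero, so each vanishes at `d`, and
the equality case puts `d` in its kernel. Iterating replaces every weighted slot by an arbitrary
generator. -/
theorem sum_mul_absDet_eq_zero (hx : ∀ i, 0 < x i)
    (hv : Submodule.span ℝ (Set.range v) = ⊤) {k : ℕ} {s : Multiset E}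
    (hs : s.card + k + 2 = n) {d : ι → ℝ} (hd : ∀ a, mixedForm e v x k s d a = 0)
    {t : Multiset ι} (ht : t.card = k + 1) :
    ∑ j, d j * absDet e (v j ::ₘ (t.map v + s)) = 0 := by
  induction k generalizing s t with
  | zero =>
    obtain ⟨i, rfl⟩ := Multiset.card_eq_one.1 ht
    have := hd (Pi.single i 1)
    rw [mixedForm_single_right] at this
    simpa [mixedDet] using this
  | succ k ih =>
    obtain ⟨i, ht'⟩ := Multiset.card_pos_iff_exists_mem.1 (by omega : 0 < t.card)
    obtain ⟨t, rfl⟩ := Multiset.exists_cons_of_mem ht'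
    have hzero : ∀ m, mixedForm e v x k (v m ::ₘ s) x d = 0 := by
      intro m
      have := hd (Pi.single m 1)
      rw [mixedForm_single_right] at this
      rw [mixedForm_self_left, ← this]
      exact Finset.sum_congr rfl fun j _ => mul_comm _ _
    have hcard : ∀ m, (v m ::ₘ s).card + k + 2 = n := fun m => by simp; omega
    have hself : ∀ m, mixedForm e v x k (v m ::ₘ s) d d = 0 := by
      have h := hd d
      rw [mixedForm_succ, Finset.sum_eq_zero_iff_of_nonpos
        fun m _ => mul_nonpos_of_nonneg_of_nonpos (hx m).le
          (mixedForm_nonpos e hx hv (hcard m) (hzero m))] at h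
      exact fun m => (mul_eq_zero.1 (h m (Finset.mem_univ _))).resolve_left (hx m).ne'
    have := ih (hcard i) (mixedForm_eq_zero_of_eq_zero e hx hv (hcard i) (hzero i) (hself i))
      (t := t) (by simpa using ht)
    simpa using this

end MixedForm

/-- A function whose `n`-th root is concave and whose derivatives at both endpoints of `[0, 1]`
are `n` times its increment is constant there. -/
theorem deriv_eq_zero_of_rpow_concave {g g' g'' : ℝ → ℝ} {n : ℕ} (hn : 2 ≤ n)
    (hg : ∀ t, HasDerivAt g (g' t) t) (hg' : ∀ t, HasDerivAt g' (g'' t) t)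
    (hpos : ∀ t ∈ Set.Icc (0 : ℝ) 1, 0 < g t)
    (hq : ∀ t ∈ Set.Ioo (0 : ℝ) 1, n * (g t * g'' t) ≤ (n - 1) * g' t ^ 2)
    (h0 : g' 0 = n * (g 1 - g 0)) (h1 : g' 1 = n * (g 1 - g 0)) :
    ∀ t ∈ Set.Ioo (0 : ℝ) 1, g' t = 0 ∧ g'' t = 0 := by
  have hn0 : (0 : ℝ) < n := by positivity
  have hn1 : (2 : ℝ) ≤ n := by exact_mod_cast hn
  set p : ℝ := (n : ℝ)⁻¹ with hp
  have hp0 : 0 < p := by positivity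
  have hp1 : p < 1 := inv_lt_one_of_one_lt₀ (by linarith)
  have hnp : p * n = 1 := inv_mul_cancel₀ hn0.ne'
  set q : ℝ → ℝ := fun t => g t ^ p with hqdef
  have hqd : ∀ t ∈ Set.Icc (0 : ℝ) 1, HasDerivAt q (g' t * p * g t ^ (p - 1)) t := fun t ht =>
    (hg t).rpow_const (Or.inl (hpos t ht).ne')
  have hqdd : ∀ t ∈ Set.Icc (0 : ℝ) 1, HasDerivAt (fun t => g' t * p * g t ^ (p - 1))
      (g'' t * p * g t ^ (p - 1) + g' t * p * (g' t * (p - 1) * g t ^ (p - 1 - 1))) t :=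
    fun t ht => ((hg' t).mul_const p).mul ((hg t).rpow_const (Or.inl (hpos t ht).ne'))
  -- The second derivative of `g ^ (1 / n)` is a positive multiple of `n * g * g'' - (n - 1) * g' ^
  -- 2`.
  have hconc : ConcaveOn ℝ (Set.Icc 0 1) q := by
    refine concaveOn_of_hasDerivWithinAt2_nonpos (convex_Icc 0 1)
      (fun t ht => (hqd t ht).continuousAt.continuousWithinAt)
      (fun t ht => (hqd t (interior_subset ht)).hasDerivWithinAt)
      (fun t ht => (hqdd t (interior_subset ht)).hasDerivWithinAt) fun t ht => ?_
    have hgt := hpos t (interior_subset ht)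
    rw [interior_Icc] at ht
    have e1 : g t ^ (p - 1) = g t ^ (p - 1 - 1) * g t := by
      rw [← Real.rpow_add_one hgt.ne']; ring_nf
    have e2 : g'' t * p * g t ^ (p - 1) + g' t * p * (g' t * (p - 1) * g t ^ (p - 1 - 1)) =
        p ^ 2 * g t ^ (p - 1 - 1) * (n * (g t * g'' t) - (n - 1) * g' t ^ 2) := by
      rw [e1]
      linear_combination (g'' t * p * (g t ^ (p - 1 - 1) * g t)
        - g' t ^ 2 * p * g t ^ (p - 1 - 1)) * (-hnp)
    rw [e2]
    exact mul_nonpos_of_nonneg_of_nonpos (by positivity) (by linarith [hq t ht])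
  have m0 : (0 : ℝ) ∈ Set.Icc (0 : ℝ) 1 := by simp
  have m1 : (1 : ℝ) ∈ Set.Icc (0 : ℝ) 1 := by simp
  have hg0 := hpos 0 m0
  have hg1 := hpos 1 m1
  have hq0 : 0 < q 0 := Real.rpow_pos_of_pos hg0 p
  have hq1 : 0 < q 1 := Real.rpow_pos_of_pos hg1 p
  have hsub : ∀ t, 0 < g t → g t ^ (p - 1) = q t / g t := fun t ht =>
    Real.rpow_sub_one ht.ne' p
  have s0 := hconc.slope_le_of_hasDerivAt m0 m1 zero_lt_one (hqd 0 m0)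
  have s1 := hconc.le_slope_of_hasDerivAt m0 m1 zero_lt_one (hqd 1 m1)
  rw [slope_def_field, hsub _ hg0, h0] at s0
  rw [slope_def_field, hsub _ hg1, h1] at s1
  -- The tangents at the two endpoints give opposite inequalities between `q 1 * g 0` and `q 0 * g
  -- 1`; equality forces `g 0 = g 1` because the exponent `1 - p` is nonzero.
  have s0' : q 1 * g 0 ≤ q 0 * g 1 := by
    have : (n * (g 1 - g 0) * p * (q 0 / g 0)) = (p * n) * (q 0 * g 1 / g 0 - q 0) := by
      field_simp
    rw [this, hnp] at s0
    have : q 1 ≤ q 0 * g 1 / g 0 := by linarith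
    rwa [le_div_iff₀ hg0] at this
  have s1' : q 0 * g 1 ≤ q 1 * g 0 := by
    have : (n * (g 1 - g 0) * p * (q 1 / g 1)) = (p * n) * (q 1 - q 1 * g 0 / g 1) := by
      field_simp
    rw [this, hnp] at s1
    have : q 0 ≤ q 1 * g 0 / g 1 := by linarith
    rwa [le_div_iff₀ hg1] at this
  have hg01 : g 1 = g 0 := by
    have h := le_antisymm s0' s1'
    have f0 : g 0 = q 0 * g 0 ^ (1 - p) := by
      rw [hqdef, ← Real.rpow_add hg0]; simp
    have f1 : g 1 = q 1 * g 1 ^ (1 - p) := by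
      rw [hqdef, ← Real.rpow_add hg1]; simp
    have h' : q 0 * q 1 * g 0 ^ (1 - p) = q 0 * q 1 * g 1 ^ (1 - p) := by
      rw [mul_assoc, mul_assoc, ← f1]; nth_rewrite 1 [mul_left_comm]; rw [← f0, h]
    have h'' := mul_left_cancel₀ (mul_pos hq0 hq1).ne' h'
    exact ((Real.rpow_left_inj hg0.le hg1.le (by linarith)).1 h'').symm
  have hq01 : q 1 = q 0 := by simp only [hqdef, hg01]
  have hconst : ∀ t ∈ Set.Ioo (0 : ℝ) 1, g t = g 0 := by
    intro t ht
    have mt := Set.Ioo_subset_Icc_self ht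
    have hle := hconc.slope_le_of_hasDerivAt m0 mt ht.1 (hqd 0 m0)
    rw [slope_def_field, h0, hg01, sub_self] at hle
    have hle' : q t ≤ q 0 := by
      have : (q t - q 0) / (t - 0) ≤ 0 := by simpa using hle
      rw [div_le_iff₀ (by linarith [ht.1])] at this
      linarith
    have hge := hconc.2 m0 m1 (sub_nonneg.2 mt.2) mt.1 (sub_add_cancel 1 t)
    simp only [smul_eq_mul, mul_zero, mul_one, zero_add, hq01] at hge
    have heq : q t = q 0 := le_antisymm hle' (by linarith)
    exact (Real.rpow_left_inj (hpos t mt).le hg0.le hp0.ne').1 heq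
  have hz : ∀ t ∈ Set.Ioo (0 : ℝ) 1, g' t = 0 := fun t ht =>
    (hg t).unique ((hasDerivAt_const t (g 0)).congr_of_eventuallyEq
      (Filter.eventually_of_mem (isOpen_Ioo.mem_nhds ht) hconst))
  exact fun t ht => ⟨hz t ht, (hg' t).unique ((hasDerivAt_const t (0 : ℝ)).congr_of_eventuallyEq
      (Filter.eventually_of_mem (isOpen_Ioo.mem_nhds ht) hz))⟩

/-! ### Minkowski uniqueness along a segment of weights. -/

section Uniqueness

variable {E : Type*} [AddCommGroup E] [Module ℝ E] {n : ℕ} (e : Module.Basis (Fin n) ℝ E)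
variable {ι : Type*} [Fintype ι] (v : ι → E)

/-- The `k` weighted slots are interchangeable, so the product rule gives `k` equal terms. For `k =
0` the factor `k` hides the truncated `k - 1`. -/
theorem hasDerivAt_mixedDet (x d : ι → ℝ) (k : ℕ) (s : Multiset E) (t : ℝ) :
    HasDerivAt (fun t : ℝ => mixedDet e v (x + t • d) k s)
      (k * ∑ i, d i * mixedDet e v (x + t • d) (k - 1) (v i ::ₘ s)) t := by
  induction k generalizing s with
  | zero => simpa [mixedDet] using hasDerivAt_const t (absDet e s)
  | succ k ih =>
    have hx : ∀ i, HasDerivAt (fun t : ℝ => (x + t • d) i) (d i) t := fun i => by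
      simpa using ((hasDerivAt_id t).mul_const (d i)).const_add (x i)
    have h := HasDerivAt.fun_sum fun i (_ : i ∈ Finset.univ) => (hx i).fun_mul (ih (v i ::ₘ s))
    simp only [mixedDet]
    refine h.congr_deriv ?_
    rw [Finset.sum_add_distrib]
    have : ∑ i, (x + t • d) i * (k * ∑ j, d j * mixedDet e v (x + t • d) (k - 1)
        (v j ::ₘ v i ::ₘ s)) = k * ∑ j, d j * mixedDet e v (x + t • d) k (v j ::ₘ s) := by
      cases k with
      | zero => simp
      | succ k =>
        simp only [mixedDet, Finset.mul_sum, Nat.add_sub_cancel]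
        rw [Finset.sum_comm]
        exact Finset.sum_congr rfl fun j _ => Finset.sum_congr rfl fun i _ => by
          rw [Multiset.cons_swap]; ring
    rw [this]
    push_cast
    ring

/-- The gradient of the volume polynomial determines the weights, up to a virtual zonotope on
which all the mixed determinants vanish. -/
theorem sum_sub_mul_absDet_eq_zero (hn : 2 ≤ n) {x y : ι → ℝ} (hx : ∀ i, 0 ≤ x i)
    (hy : ∀ i, 0 ≤ y i) (hxy : ∀ i, 0 < x i ∨ 0 < y i)
    (hv : Submodule.span ℝ (Set.range v) = ⊤)
    (hVx : 0 < mixedDet e v x n 0) (hVy : 0 < mixedDet e v y n 0)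
    (h : ∀ i, mixedDet e v x (n - 1) {v i} = mixedDet e v y (n - 1) {v i})
    {t : Multiset ι} (ht : t.card = n - 1) :
    ∑ j, (y j - x j) * absDet e (v j ::ₘ t.map v) = 0 := by
  classical
  obtain ⟨m, rfl⟩ := Nat.exists_eq_add_of_le' hn
  set d : ι → ℝ := y - x with hd
  set z : ℝ → ι → ℝ := fun t => x + t • d with hz
  have hz0 : z 0 = x := by simp [hz]
  have hz1 : z 1 = y := by simp [hz, hd]
  have hzpos : ∀ t ∈ Set.Ioo (0 : ℝ) 1, ∀ i, 0 < z t i := by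
    intro t ht i
    have e1 : z t i = (1 - t) * x i + t * y i := by simp [hz, hd]; ring
    rw [e1]
    have h1 : 0 < 1 - t := by linarith [ht.2]
    have h2 := ht.1
    rcases hxy i with h | h
    · have := hy i; positivity
    · have := hx i; positivity
  set Q := fun t => mixedForm e v (z t) m 0 with hQ
  have hQzz : ∀ t, Q t (z t) (z t) = mixedDet e v (z t) (m + 2) 0 := fun t =>
    mixedForm_self_self e m 0
  have hQzd : ∀ t, Q t (z t) d = ∑ i, d i * mixedDet e v (z t) (m + 1) {v i} := fun t => by
    rw [hQ, mixedForm_self_left]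
    exact Finset.sum_congr rfl fun i _ => by rw [mul_comm]; rfl
  have hQdd : ∀ t, Q t d d = ∑ i, d i * ∑ j, d j * mixedDet e v (z t) m (v j ::ₘ {v i}) :=
    fun t => by
      rw [hQ, mixedForm_apply]
      exact Finset.sum_congr rfl fun i _ => by
        congr 1
        exact Finset.sum_congr rfl fun j _ => by rw [mul_comm, Multiset.cons_swap]; rfl
  have hg : ∀ t, HasDerivAt (fun t => mixedDet e v (z t) (m + 2) 0)
      ((m + 2 : ℕ) * Q t (z t) d) t := fun t => by
    rw [hQzd]
    exact hasDerivAt_mixedDet e v x d (m + 2) 0 t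
  have hg' : ∀ t, HasDerivAt (fun t => ((m + 2 : ℕ) : ℝ) * Q t (z t) d)
      ((m + 2 : ℕ) * ((m + 1 : ℕ) * Q t d d)) t := fun t => by
    refine HasDerivAt.const_mul _ ?_
    simp_rw [hQzd, hQdd]
    refine (HasDerivAt.fun_sum fun i (_ : i ∈ Finset.univ) =>
      (hasDerivAt_mixedDet e v x d (m + 1) {v i} t).const_mul (d i)).congr_deriv ?_
    rw [Finset.mul_sum]
    exact Finset.sum_congr rfl fun i _ => by
      simp only [Nat.add_sub_cancel, hz]; ring
  have hpos : ∀ t ∈ Set.Icc (0 : ℝ) 1, 0 < mixedDet e v (z t) (m + 2) 0 := by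
    intro t ht
    rcases ht.1.eq_or_lt with h | h
    · rwa [← h, hz0]
    rcases ht.2.eq_or_lt with h' | h'
    · rwa [h', hz1]
    · rw [mixedDet_pos_iff e v _ (hzpos t ⟨h, h'⟩) hv (by simp)]
      have : {q : E | q ∈ (0 : Multiset E)} = ∅ := by ext; simp
      rw [this, Submodule.span_empty, finrank_bot, Multiset.card_zero]
  have hcs : ∀ t ∈ Set.Ioo (0 : ℝ) 1, Q t (z t) (z t) * Q t d d ≤ Q t (z t) d ^ 2 := by
    intro t ht
    have hp : 0 < Q t (z t) (z t) := by
      rw [hQzz]; exact hpos t (Set.Ioo_subset_Icc_self ht)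
    have h1 : Q t (z t) (d - (Q t (z t) d / Q t (z t) (z t)) • z t) = 0 := by simp [hp.ne']
    have h2 := mixedForm_nonpos e (hzpos t ht) hv (k := m) (s := 0) (by simp) h1
    have hcomm : Q t d (z t) = Q t (z t) d := mixedForm_comm e m 0 _ _
    change Q t _ _ ≤ 0 at h2
    simp only [map_sub, map_smul, LinearMap.sub_apply, LinearMap.smul_apply, smul_eq_mul,
      hcomm, div_mul_cancel₀ _ hp.ne', sub_self, mul_zero, sub_zero] at h2
    have h3 : Q t (z t) (z t) * (Q t d d - Q t (z t) d / Q t (z t) (z t) * Q t (z t) d) ≤ 0 :=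
      mul_nonpos_of_nonneg_of_nonpos hp.le h2
    have h4 : Q t (z t) (z t) * (Q t d d - Q t (z t) d / Q t (z t) (z t) * Q t (z t) d) =
      Q t (z t) (z t) * Q t d d - Q t (z t) d ^ 2 := by field_simp
    linarith
  have hsum : ∀ w : ι → ℝ, ∑ i, w i * mixedDet e v w (m + 1) {v i} = mixedDet e v w (m + 2) 0 :=
    fun w => rfl
  -- By homogeneity each volume is its gradient paired with its weights; as the gradients agree,
  -- pairing with `d` gives the difference of the volumes.
  have hd1 : Q 1 (z 1) d = mixedDet e v (z 1) (m + 2) 0 - mixedDet e v (z 0) (m + 2) 0 := by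
    rw [hQzd, hz0, hz1, ← hsum x, ← hsum y, ← Finset.sum_sub_distrib]
    refine Finset.sum_congr rfl fun i _ => ?_
    have := h i
    simp only [Nat.reduceSubDiff] at this
    simp only [hd, Pi.sub_apply, this]; ring
  have hd0 : Q 0 (z 0) d = Q 1 (z 1) d := by
    rw [hQzd, hQzd, hz0, hz1]
    exact Finset.sum_congr rfl fun i _ => congrArg _ (h i)
  have hhalf : (1 / 2 : ℝ) ∈ Set.Ioo (0 : ℝ) 1 := by norm_num
  obtain ⟨k1, k2⟩ := deriv_eq_zero_of_rpow_concave (n := m + 2) hn hg hg' hpos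
    (fun t ht => by
      have := hcs t ht
      rw [hQzz] at this
      have h5 : (0 : ℝ) ≤ (m + 2) ^ 2 * (m + 1) := by positivity
      push_cast
      nlinarith [mul_le_mul_of_nonneg_left this h5])
    (by rw [hd0, hd1]) (by rw [hd1]) (1 / 2) hhalf
  have hm2 : ((m + 2 : ℕ) : ℝ) ≠ 0 := by positivity
  have hm1 : ((m + 1 : ℕ) : ℝ) ≠ 0 := by positivity
  have k1' := (mul_eq_zero.1 k1).resolve_left hm2
  have k2' := (mul_eq_zero.1 ((mul_eq_zero.1 k2).resolve_left hm2)).resolve_left hm1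
  have hcard : Multiset.card (0 : Multiset E) + m + 2 = m + 2 := by simp
  have := sum_mul_absDet_eq_zero e (hzpos _ hhalf) hv hcard
    (mixedForm_eq_zero_of_eq_zero e (hzpos _ hhalf) hv hcard k1' k2') (t := t) (by omega)
  simpa [hd] using this

end Uniqueness

/-! ### Rays of a central hyperplane arrangement. -/

section Rays

variable {E : Type*} [NormedAddCommGroup E] [InnerProductSpace ℝ E]
variable {ι : Type*} [Fintype ι] (v : ι → E)

theorem exists_inner_ne_zero_of_span_eq_top {κ : Type*} {v : κ → E}
    (hv : Submodule.span ℝ (Set.range v) = ⊤) {w : E} (hw : w ≠ 0) : ∃ i, inner ℝ (v i) w ≠ 0 := by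
  by_contra! h
  have hle : Submodule.span ℝ (Set.range v) ≤ (ℝ ∙ w)ᗮ := by
    rw [Submodule.span_le]
    rintro _ ⟨i, rfl⟩
    rw [SetLike.mem_coe, Submodule.mem_orthogonal_singleton_iff_inner_left]
    exact h i
  have hw' : w ∈ (ℝ ∙ w)ᗮ := hle (hv ▸ trivial)
  rw [Submodule.mem_orthogonal_singleton_iff_inner_left, inner_self_eq_zero] at hw'
  exact hw hw'

/-- Moving from `w` along `-τ • z` reaches a new hyperplane first at `i₀`: the smallest ratio
ensures that no other sign changes on the way. -/
theorem exists_min_ratio {w z : E} (h : ∃ i, inner ℝ (v i) z ≠ 0)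
    (hzw : ∀ i, inner ℝ (v i) w = 0 → inner ℝ (v i) z = 0) :
    ∃ (i₀ : ι) (τ : ℝ), inner ℝ (v i₀) w ≠ 0 ∧ inner ℝ (v i₀) z ≠ 0 ∧
      inner ℝ (v i₀) w = τ * inner ℝ (v i₀) z ∧
      ∀ i, |τ * inner ℝ (v i) z| ≤ |inner ℝ (v i) w| := by
  classical
  obtain ⟨i₀, hi₀, hmin⟩ := Finset.exists_min_image
    (Finset.univ.filter fun i => inner ℝ (v i) z ≠ 0)
    (fun i => |inner ℝ (v i) w / inner ℝ (v i) z|) (by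
      obtain ⟨i, hi⟩ := h; exact ⟨i, by simpa using hi⟩)
  have hz0 : inner ℝ (v i₀) z ≠ 0 := by simpa using hi₀
  refine ⟨i₀, inner ℝ (v i₀) w / inner ℝ (v i₀) z, fun h0 => hz0 (hzw _ h0), hz0,
    (div_mul_cancel₀ _ hz0).symm, fun i => ?_⟩
  by_cases hi : inner ℝ (v i) z = 0
  · simp [hi]
  · have := hmin i (by simpa using hi)
    rw [abs_mul]
    rwa [abs_div (inner ℝ (v i) w), le_div_iff₀ (abs_pos.2 hi)] at this

/-- The subspace spanned by the vectors `v i` orthogonal to `w`. -/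
def orthSpan {κ : Type*} (v : κ → E) (w : E) : Submodule ℝ E :=
  Submodule.span ℝ {p | ∃ i, v i = p ∧ inner ℝ (v i) w = 0}

theorem orthSpan_le {κ : Type*} (v : κ → E) (w : E) :
    orthSpan v w ≤ (ℝ ∙ w)ᗮ := by
  rw [orthSpan, Submodule.span_le]
  rintro _ ⟨i, rfl, hi⟩
  rwa [SetLike.mem_coe, Submodule.mem_orthogonal_singleton_iff_inner_left]

/-- `r` lies in the closed cone of the central hyperplane arrangement of `v` that is determined by
the point `w`. -/
def InClosedCone {κ : Type*} (v : κ → E) (w r : E) : Prop :=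
  ∀ i, (0 ≤ inner ℝ (v i) w → 0 ≤ inner ℝ (v i) r) ∧ (inner ℝ (v i) w ≤ 0 → inner ℝ (v i) r ≤ 0)

theorem InClosedCone.eq_zero {κ : Type*} {v : κ → E} {w r : E} (h : InClosedCone v w r) {i : κ}
    (hi : inner ℝ (v i) w = 0) : inner ℝ (v i) r = 0 :=
  le_antisymm ((h i).2 hi.le) ((h i).1 hi.ge)

theorem card_support_sub_lt {w z : E} {τ : ℝ} {i₀ : ι} (h1 : inner ℝ (v i₀) w ≠ 0)
    (h3 : inner ℝ (v i₀) w = τ * inner ℝ (v i₀) z)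
    (hzw : ∀ i, inner ℝ (v i) w = 0 → inner ℝ (v i) z = 0) :
    {i | inner ℝ (v i) (w - τ • z) ≠ 0}.ncard < {i | inner ℝ (v i) w ≠ 0}.ncard := by
  refine Set.ncard_lt_ncard ⟨fun i hi h0 => hi ?_, fun h => h h1 ?_⟩ (Set.toFinite _)
  · rw [inner_sub_right, inner_smul_right, h0, hzw i h0]; simp
  · rw [inner_sub_right, inner_smul_right, h3, sub_self]

variable [FiniteDimensional ℝ E]

/-- Every closed cone of a central hyperplane arrangement contains a ray. -/
theorem exists_ray (hv : Submodule.span ℝ (Set.range v) = ⊤) {w : E} (hw : w ≠ 0) :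
    ∃ r : E, r ≠ 0 ∧ InClosedCone v w r ∧
      Module.finrank ℝ (orthSpan v r) + 1 = Module.finrank ℝ E := by
  induction hN : {i | inner ℝ (v i) w ≠ 0}.ncard using Nat.strong_induction_on generalizing w with
  | _ N ih =>
  subst hN
  have h1 : Module.finrank ℝ (ℝ ∙ w) = 1 := finrank_span_singleton hw
  have h2 := Submodule.finrank_mono (orthSpan_le v w)
  have h3 := (ℝ ∙ w).finrank_add_finrank_orthogonal
  by_cases hc : Module.finrank ℝ (orthSpan v w) + 1 = Module.finrank ℝ E
  · exact ⟨w, hw, fun i => ⟨id, id⟩, hc⟩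
  have h4 := Submodule.finrank_add_le_finrank_add_finrank (orthSpan v w) (ℝ ∙ w)
  have h5 := (orthSpan v w ⊔ (ℝ ∙ w)).finrank_add_finrank_orthogonal
  -- If `w` is not yet on a ray, some direction is orthogonal both to `w` and to every generator
  -- orthogonal to `w`. Orthogonality to `w` keeps the moved point nonzero.
  have h6 : 0 < Module.finrank ℝ ((orthSpan v w ⊔ (ℝ ∙ w))ᗮ : Submodule ℝ E) := by omega
  have := Module.finrank_pos_iff.1 h6
  obtain ⟨⟨z, hz⟩, hz0⟩ := exists_ne (0 : ((orthSpan v w ⊔ (ℝ ∙ w))ᗮ : Submodule ℝ E))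
  have hz0' : z ≠ 0 := fun h => hz0 (by ext; exact h)
  have hzw : inner ℝ w z = 0 :=
    hz w (Submodule.mem_sup_right (Submodule.mem_span_singleton_self w))
  have hzv : ∀ i, inner ℝ (v i) w = 0 → inner ℝ (v i) z = 0 := fun i hi =>
    hz _ (Submodule.mem_sup_left (Submodule.subset_span ⟨i, rfl, hi⟩))
  obtain ⟨i₀, τ, k1, k2, k3, k4⟩ :=
    exists_min_ratio v (exists_inner_ne_zero_of_span_eq_top hv hz0') hzv
  have hw' : w - τ • z ≠ 0 := by
    intro h
    have h7 : inner ℝ w (w - τ • z) = 0 := by rw [h, inner_zero_right]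
    rw [inner_sub_right, inner_smul_right, hzw, mul_zero, sub_zero] at h7
    exact hw (inner_self_eq_zero.1 h7)
  obtain ⟨r, hr0, hr, hrk⟩ := ih _ (card_support_sub_lt v k1 k3 hzv) hw' rfl
  refine ⟨r, hr0, fun i => ?_, hrk⟩
  have h8 := hr i
  have h9 := k4 i
  rw [inner_sub_right, inner_smul_right] at h8
  have h10 := abs_le.1 h9
  constructor
  · intro h
    rw [abs_of_nonneg h] at h10
    exact h8.1 (by linarith)
  · intro h
    rw [abs_of_nonpos h] at h10
    exact h8.2 (by linarith)

theorem sum_mul_abs_inner_eq_zero (hv : Submodule.span ℝ (Set.range v) = ⊤) {d : ι → ℝ}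
    (hd : ∀ r : E, r ≠ 0 → Module.finrank ℝ (orthSpan v r) + 1 = Module.finrank ℝ E →
      ∑ i, d i * |inner ℝ (v i) r| = 0) (w : E) :
    ∑ i, d i * |inner ℝ (v i) w| = 0 := by
  induction hN : {i | inner ℝ (v i) w ≠ 0}.ncard using Nat.strong_induction_on generalizing w with
  | _ N ih =>
  subst hN
  by_cases hw : w = 0
  · simp [hw]
  obtain ⟨r, hr0, hr, hrk⟩ := exists_ray v hv hw
  have hzv : ∀ i, inner ℝ (v i) w = 0 → inner ℝ (v i) r = 0 := fun i hi => hr.eq_zero hi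
  obtain ⟨i₀, τ, k1, k2, k3, k4⟩ :=
    exists_min_ratio v (exists_inner_ne_zero_of_span_eq_top hv hr0) hzv
  have hτ : 0 ≤ τ := by
    by_contra! hτ
    rcases lt_or_gt_of_ne k2 with h | h
    · exact absurd ((hr i₀).1 (by rw [k3]; nlinarith)) (not_le.2 h)
    · exact absurd ((hr i₀).2 (by rw [k3]; nlinarith)) (not_le.2 h)
  -- The points `w - τ • r` and `r` lie in the closed cone of `w`, where absolute values add; the
  -- former has fewer nonzero inner products.
  have key : ∀ i, |inner ℝ (v i) w| = |inner ℝ (v i) (w - τ • r)| + τ * |inner ℝ (v i) r| := by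
    intro i
    have h1 := k4 i
    rw [inner_sub_right, inner_smul_right]
    rcases le_total 0 (inner ℝ (v i) w) with h | h
    · have h2 := (hr i).1 h
      rw [abs_of_nonneg (mul_nonneg hτ h2), abs_of_nonneg h] at h1
      rw [abs_of_nonneg h, abs_of_nonneg h2, abs_of_nonneg (by linarith)]; ring
    · have h2 := (hr i).2 h
      rw [abs_of_nonpos (mul_nonpos_of_nonneg_of_nonpos hτ h2), abs_of_nonpos h] at h1
      rw [abs_of_nonpos h, abs_of_nonpos h2, abs_of_nonpos (by linarith)]; ring
  have h1 := ih _ (card_support_sub_lt v k1 k3 hzv) _ rfl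
  have h2 := hd r hr0 hrk
  simp_rw [key, mul_add, Finset.sum_add_distrib, h1, mul_left_comm _ τ, ← Finset.mul_sum, h2]
  simp

end Rays

/-! ### Determinants and hyperplane normals. -/

section Normal

variable {E : Type*} [NormedAddCommGroup E] [InnerProductSpace ℝ E]
variable {n : ℕ} (e : Module.Basis (Fin n) ℝ E)

theorem absDet_eq_zero_of_inner_eq_zero {s : Multiset E} (hs : s.card = n) {u : E} (hu : u ≠ 0)
    (h : ∀ p ∈ s, inner ℝ p u = 0) : absDet e s = 0 := by
  by_contra h0
  have h1 := (absDet_pos_iff e hs).1 ((absDet_nonneg e s).lt_of_ne' h0)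
  have h2 : Submodule.span ℝ {p | p ∈ s} ≤ (ℝ ∙ u)ᗮ := by
    rw [Submodule.span_le]
    intro p hp
    rw [SetLike.mem_coe, Submodule.mem_orthogonal_singleton_iff_inner_left]
    exact h p hp
  rw [h1, top_le_iff] at h2
  have h3 : u ∈ (ℝ ∙ u)ᗮ := h2 ▸ trivial
  rw [Submodule.mem_orthogonal_singleton_iff_inner_left, inner_self_eq_zero] at h3
  exact hu h3

/-- The component of `p` orthogonal to `u` lies in the same hyperplane as `s` and drops out of the
determinant. -/
theorem absDet_cons_of_inner_eq_zero {s : Multiset E} (hs : s.card + 1 = n) {u : E}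
    (hu : ‖u‖ = 1) (h : ∀ p ∈ s, inner ℝ p u = 0) (p : E) :
    absDet e (p ::ₘ s) = |inner ℝ p u| * absDet e (u ::ₘ s) := by
  have h1 : p = (inner ℝ p u : ℝ) • u + (p - (inner ℝ p u : ℝ) • u) := by abel
  have h2 : absDet e ((p - (inner ℝ p u : ℝ) • u) ::ₘ s) = 0 := by
    refine absDet_eq_zero_of_inner_eq_zero e (by simpa using hs) (u := u)
      (by rintro rfl; simp at hu) fun q hq => ?_
    rcases Multiset.mem_cons.1 hq with rfl | hq
    · rw [inner_sub_left, inner_smul_left, real_inner_self_eq_norm_sq, hu]; simp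
    · exact h q hq
  nth_rewrite 1 [h1]
  rw [absDet_cons_add e h2, absDet_cons_smul]

theorem exists_multiset_of_finrank_orthSpan [FiniteDimensional ℝ E] {ι : Type*} {v : ι → E} {r : E} (hr : r ≠ 0)
    (h : Module.finrank ℝ (orthSpan v r) + 1 = n) :
    ∃ t : Multiset ι, t.card + 1 = n ∧ (∀ p ∈ t.map v, inner ℝ p r = 0) ∧
      0 < absDet e (r ::ₘ t.map v) := by
  obtain ⟨f, hf1, hf2, hf3⟩ :=
    Submodule.exists_fun_fin_finrank_span_eq ℝ {p | ∃ i, v i = p ∧ inner ℝ (v i) r = 0}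
  choose g hg1 hg2 using hf1
  refine ⟨Finset.univ.val.map g, by
    rw [Multiset.card_map, Finset.card_val, Finset.card_univ, Fintype.card_fin]; exact h, ?_, ?_⟩
  · simp only [Multiset.map_map, Multiset.mem_map]
    rintro _ ⟨i, -, rfl⟩
    exact hg2 i
  · have hgf : v ∘ g = f := funext hg1
    rw [absDet_pos_iff e (by
      rw [Multiset.card_cons, Multiset.card_map, Multiset.card_map, Finset.card_val,
        Finset.card_univ, Fintype.card_fin]; exact h), Multiset.map_map, hgf]
    have hset : {p | p ∈ r ::ₘ Multiset.map f Finset.univ.val} = {r} ∪ Set.range f := by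
      ext p; simp [eq_comm]
    rw [hset, Submodule.span_union, hf2]
    change (ℝ ∙ r) ⊔ orthSpan v r = ⊤
    have h1 : Module.finrank ℝ (ℝ ∙ r) = 1 := finrank_span_singleton hr
    have h2 := Submodule.finrank_sup_add_finrank_inf_eq (ℝ ∙ r) (orthSpan v r)
    have h3 : (ℝ ∙ r) ⊓ orthSpan v r = ⊥ :=
      ((ℝ ∙ r).orthogonal_disjoint.mono_right (orthSpan_le v r)).eq_bot
    rw [h3, finrank_bot] at h2
    have hn : Module.finrank ℝ E = n := by simp [Module.finrank_eq_card_basis e]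
    exact Submodule.eq_top_of_finrank_eq (by omega)

/-- A virtual zonotope on which all the mixed determinants vanish is trivial. -/
theorem sum_mul_abs_inner_eq_zero_of_absDet [FiniteDimensional ℝ E] {ι : Type*} [Fintype ι]
    {v : ι → E}
    (hv : Submodule.span ℝ (Set.range v) = ⊤) {d : ι → ℝ}
    (hd : ∀ t : Multiset ι, t.card + 1 = n → ∑ j, d j * absDet e (v j ::ₘ t.map v) = 0) (w : E) :
    ∑ i, d i * |inner ℝ (v i) w| = 0 := by
  have hn : Module.finrank ℝ E = n := by simp [Module.finrank_eq_card_basis e]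
  refine sum_mul_abs_inner_eq_zero v hv (fun r hr0 hr => ?_) w
  rw [hn] at hr
  obtain ⟨t, ht, hto, hpos⟩ := exists_multiset_of_finrank_orthSpan e hr0 hr
  set u := ‖r‖⁻¹ • r with hu
  have hr' : 0 < ‖r‖ := norm_pos_iff.2 hr0
  have hu1 : ‖u‖ = 1 := by rw [hu, norm_smul, norm_inv, norm_norm, inv_mul_cancel₀ hr'.ne']
  have h1 := hd t ht
  -- The last factor does not depend on `j` and is nonzero, so it can be cancelled.
  have h2 : ∀ j, absDet e (v j ::ₘ t.map v) =
      |inner ℝ (v j) r| * (‖r‖⁻¹ * absDet e (u ::ₘ t.map v)) := by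
    intro j
    rw [absDet_cons_of_inner_eq_zero e (by simpa using ht) hu1 (fun p hp => by
      rw [hu, inner_smul_right, hto p hp, mul_zero]), hu, inner_smul_right, abs_mul,
      abs_of_pos (inv_pos.2 hr')]
    ring
  simp_rw [h2, ← mul_assoc] at h1
  rw [← Finset.sum_mul, ← Finset.sum_mul] at h1
  have h3 : absDet e (u ::ₘ t.map v) ≠ 0 := by
    rw [hu, absDet_cons_smul]; positivity
  exact (mul_eq_zero.1 ((mul_eq_zero.1 h1).resolve_right h3)).resolve_right (by positivity)

end Normal

/-! ### Support functions and faces of zonotopes. -/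

section Zonotope

variable {E : Type*} [NormedAddCommGroup E] [InnerProductSpace ℝ E]
variable {κ : Type*} [Fintype κ] (a : κ → E)

/-- The zonotope generated by a finite family of vectors. -/
def zonotopeOf {E : Type*} [AddCommGroup E] [Module ℝ E] {κ : Type*} [Fintype κ] (a : κ → E) :
    Set E :=
  {x | ∃ t : κ → ℝ, (∀ i, 0 ≤ t i ∧ t i ≤ 1) ∧ x = ∑ i, t i • a i}

theorem zonotopeOf_eq_image {E : Type*} [AddCommGroup E] [Module ℝ E] (a : κ → E) :
    zonotopeOf a = Fintype.linearCombination ℝ a '' Set.Icc 0 1 := by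
  ext x
  constructor
  · rintro ⟨t, ht, rfl⟩
    exact ⟨t, ⟨fun i => (ht i).1, fun i => (ht i).2⟩, rfl⟩
  · rintro ⟨t, ht, rfl⟩
    exact ⟨t, fun i => ⟨ht.1 i, ht.2 i⟩, rfl⟩

theorem convex_zonotopeOf {E : Type*} [AddCommGroup E] [Module ℝ E] (a : κ → E) :
    Convex ℝ (zonotopeOf a) := by
  rw [zonotopeOf_eq_image]
  exact (convex_Icc 0 1).linear_image _

theorem isCompact_zonotopeOf {E : Type*} [AddCommGroup E] [Module ℝ E] [TopologicalSpace E]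
    [ContinuousAdd E] [ContinuousSMul ℝ E] (a : κ → E) : IsCompact (zonotopeOf a) := by
  rw [zonotopeOf_eq_image]
  refine isCompact_Icc.image ?_
  change Continuous fun t : κ → ℝ => ∑ i, t i • a i
  fun_prop

theorem zero_mem_zonotopeOf {E : Type*} [AddCommGroup E] [Module ℝ E] (a : κ → E) :
    (0 : E) ∈ zonotopeOf a := ⟨0, by simp, by simp⟩

theorem mem_zonotopeOf_self {E : Type*} [AddCommGroup E] [Module ℝ E] (a : κ → E) (i : κ) :
    a i ∈ zonotopeOf a := by
  classical
  refine ⟨Pi.single i 1, fun j => ?_, by simp [Pi.single_apply]⟩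
  by_cases h : j = i <;> simp [h]

theorem vectorSpan_zonotopeOf : vectorSpan ℝ (zonotopeOf a) = Submodule.span ℝ (Set.range a) := by
  apply le_antisymm
  · rw [vectorSpan_def, Submodule.span_le]
    have h : ∀ x ∈ zonotopeOf a, x ∈ Submodule.span ℝ (Set.range a) := by
      rintro _ ⟨t, -, rfl⟩
      exact Submodule.sum_mem _ fun i _ => Submodule.smul_mem _ _ (Submodule.subset_span ⟨i, rfl⟩)
    rintro _ ⟨x, hx, y, hy, rfl⟩
    exact Submodule.sub_mem _ (h x hx) (h y hy)
  · rw [Submodule.span_le]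
    rintro _ ⟨i, rfl⟩
    simpa using vsub_mem_vectorSpan ℝ (mem_zonotopeOf_self a i) (zero_mem_zonotopeOf a)

/-- The support function of a zonotope. -/
noncomputable def zonotopeSupport (u : E) : ℝ := ∑ i, max 0 (inner ℝ (a i) u)

theorem inner_le_zonotopeSupport {x : E} (hx : x ∈ zonotopeOf a) (u : E) :
    inner ℝ x u ≤ zonotopeSupport a u := by
  obtain ⟨t, ht, rfl⟩ := hx
  rw [sum_inner, zonotopeSupport]
  refine Finset.sum_le_sum fun i _ => ?_
  rw [inner_smul_left]
  simp only [conj_trivial]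
  rcases le_total 0 (inner ℝ (a i) u) with h | h
  · rw [max_eq_right h]; nlinarith [(ht i).2]
  · rw [max_eq_left h]; nlinarith [(ht i).1]

theorem exists_inner_eq_zonotopeSupport (u : E) :
    ∃ x ∈ zonotopeOf a, inner ℝ x u = zonotopeSupport a u := by
  classical
  refine ⟨_, ⟨fun i => if 0 ≤ inner ℝ (a i) u then 1 else 0, fun i => ?_, rfl⟩, ?_⟩
  · dsimp only; split_ifs <;> simp
  · rw [sum_inner, zonotopeSupport]
    refine Finset.sum_congr rfl fun i _ => ?_
    dsimp only
    split_ifs with h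
    · simp [h]
    · simp [(not_le.1 h).le]

theorem mem_zonotopeOf_iff [CompleteSpace E] {x : E} :
    x ∈ zonotopeOf a ↔ ∀ u, inner ℝ x u ≤ zonotopeSupport a u := by
  refine ⟨fun hx u => inner_le_zonotopeSupport a hx u, fun h => ?_⟩
  by_contra hx
  obtain ⟨l, r, hl, hr⟩ := geometric_hahn_banach_closed_point (convex_zonotopeOf a)
    (isCompact_zonotopeOf a).isClosed hx
  set u := (InnerProductSpace.toDual ℝ E).symm l with hu
  have hlu : ∀ y, l y = inner ℝ y u := fun y => by
    rw [real_inner_comm, hu, InnerProductSpace.toDual_symm_apply]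
  obtain ⟨y, hy, hyu⟩ := exists_inner_eq_zonotopeSupport a u
  have h1 := hl y hy
  have h2 := h u
  rw [hlu] at h1 hr
  linarith

theorem zonotopeSupport_eq (u : E) :
    zonotopeSupport a u = inner ℝ ((1 / 2 : ℝ) • ∑ i, a i) u + 1 / 2 * ∑ i, |inner ℝ (a i) u| := by
  rw [inner_smul_left, sum_inner, zonotopeSupport, Finset.mul_sum, Finset.mul_sum,
    ← Finset.sum_add_distrib]
  refine Finset.sum_congr rfl fun i _ => ?_
  simp only [conj_trivial]
  rcases le_total 0 (inner ℝ (a i) u) with h | h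
  · rw [max_eq_right h, abs_of_nonneg h]; ring
  · rw [max_eq_left h, abs_of_nonpos h]; ring

/-- A zonotope is symmetric about half the sum of its generators. Its support function is a linear
term given by that centre plus an even part, so equal even parts leave only a translation of
centres. -/
theorem image_add_zonotopeOf [CompleteSpace E] {κ' : Type*} [Fintype κ'] (b : κ' → E)
    (h : ∀ u, ∑ i, |inner ℝ (a i) u| = ∑ j, |inner ℝ (b j) u|) :
    (fun x => x + ((1 / 2 : ℝ) • ∑ j, b j - (1 / 2 : ℝ) • ∑ i, a i)) '' zonotopeOf a =
      zonotopeOf b := by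
  rw [Set.image_add_right]
  ext x
  rw [Set.mem_preimage, mem_zonotopeOf_iff, mem_zonotopeOf_iff]
  refine forall_congr' fun u => ?_
  rw [zonotopeSupport_eq, zonotopeSupport_eq, h, inner_add_left, inner_neg_left, inner_sub_left]
  constructor <;> intro h <;> linarith

/-- The face of a zonotope in direction `u`. -/
def zonotopeFace (u : E) : Set E := {x ∈ zonotopeOf a | inner ℝ x u = zonotopeSupport a u}

theorem mem_zonotopeFace_iff {u x : E} : x ∈ zonotopeFace a u ↔
    x ∈ zonotopeOf a ∧ ∀ y ∈ zonotopeOf a, inner ℝ u y ≤ inner ℝ u x := by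
  refine and_congr_right fun hx => ?_
  simp only [real_inner_comm _ u]
  refine ⟨fun h y hy => h ▸ inner_le_zonotopeSupport a hy u, fun h => ?_⟩
  obtain ⟨y, hy, hyu⟩ := exists_inner_eq_zonotopeSupport a u
  exact le_antisymm (inner_le_zonotopeSupport a hx u) (hyu ▸ h y hy)

theorem zonotopeFace_nonempty (u : E) : (zonotopeFace a u).Nonempty :=
  exists_inner_eq_zonotopeSupport a u

theorem inner_eq_zonotopeSupport_iff {t : κ → ℝ} (ht : ∀ i, 0 ≤ t i ∧ t i ≤ 1) (u : E) :
    inner ℝ (∑ i, t i • a i) u = zonotopeSupport a u ↔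
      ∀ i, (0 < inner ℝ (a i) u → t i = 1) ∧ (inner ℝ (a i) u < 0 → t i = 0) := by
  rw [sum_inner, zonotopeSupport, Finset.sum_eq_sum_iff_of_le]
  · simp only [Finset.mem_univ, true_implies, inner_smul_left, conj_trivial]
    refine forall_congr' fun i => ?_
    rcases lt_trichotomy 0 (inner ℝ (a i) u) with h | h | h
    · simp [h, h.le, not_lt.2 h.le, h.ne']
    · simp [← h]
    · simp [h, h.le, not_lt.2 h.le, h.ne]
  · intro i _
    simp only [inner_smul_left, conj_trivial]
    rcases le_total 0 (inner ℝ (a i) u) with h | h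
    · rw [max_eq_right h]; nlinarith [(ht i).2]
    · rw [max_eq_left h]; nlinarith [(ht i).1]

theorem zonotopeFace_subset {w r : E} (h : InClosedCone a w r) :
    zonotopeFace a w ⊆ zonotopeFace a r := by
  rintro _ ⟨⟨t, ht, rfl⟩, hw⟩
  refine ⟨⟨t, ht, rfl⟩, ?_⟩
  rw [inner_eq_zonotopeSupport_iff a ht] at hw ⊢
  refine fun i => ⟨fun hi => (hw i).1 ?_, fun hi => (hw i).2 ?_⟩
  · by_contra! h'; exact hi.not_ge ((h i).2 h')
  · by_contra! h'; exact hi.not_ge ((h i).1 h')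

open Classical in
/-- The generators of the face of a zonotope in direction `u`, extended by zero. -/
noncomputable def faceGenerator {κ : Type*} (a : κ → E) (u : E) (i : κ) : E := if inner ℝ (a i) u = 0 then a i else 0

theorem inner_faceGenerator {κ : Type*} (a : κ → E) (u : E) (i : κ) : inner ℝ (faceGenerator a u i) u = 0 := by
  rw [faceGenerator]; split_ifs with h <;> simp [h]

theorem span_range_faceGenerator {κ : Type*} (a : κ → E) (u : E) :
    Submodule.span ℝ (Set.range (faceGenerator a u)) = orthSpan a u := by
  rw [orthSpan]
  apply le_antisymm <;> rw [Submodule.span_le]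
  · rintro _ ⟨i, rfl⟩
    rw [faceGenerator]
    split_ifs with h
    · exact Submodule.subset_span ⟨i, rfl, h⟩
    · exact Submodule.zero_mem _
  · rintro _ ⟨i, rfl, h⟩
    exact Submodule.subset_span ⟨i, if_pos h⟩

/-- Maximality forces the coefficient of each generator not orthogonal to `u` to be `0` or `1`;
those equal to `1` add up to the translation. -/
theorem exists_zonotopeFace_eq_image (u : E) :
    ∃ c : E, zonotopeFace a u = (fun x => x + c) '' zonotopeOf (faceGenerator a u) := by
  classical
  refine ⟨∑ i, if 0 < inner ℝ (a i) u then a i else 0, ?_⟩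
  ext x
  constructor
  · rintro ⟨⟨t, ht, rfl⟩, hu⟩
    rw [inner_eq_zonotopeSupport_iff a ht] at hu
    refine ⟨_, ⟨t, ht, rfl⟩, ?_⟩
    dsimp only
    rw [← Finset.sum_add_distrib]
    refine Finset.sum_congr rfl fun i _ => ?_
    rw [faceGenerator]
    rcases lt_trichotomy 0 (inner ℝ (a i) u) with h | h | h
    · simp [h, h.ne', (hu i).1 h]
    · simp [← h]
    · simp [h.ne, not_lt.2 h.le, (hu i).2 h]
  · rintro ⟨_, ⟨t, ht, rfl⟩, rfl⟩
    have key : (∑ i, t i • faceGenerator a u i) + ∑ i, (if 0 < inner ℝ (a i) u then a i else 0) =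
        ∑ i, (if inner ℝ (a i) u = 0 then t i else if 0 < inner ℝ (a i) u then 1 else 0) • a i := by
      rw [← Finset.sum_add_distrib]
      refine Finset.sum_congr rfl fun i _ => ?_
      rw [faceGenerator]
      rcases lt_trichotomy 0 (inner ℝ (a i) u) with h | h | h
      · simp [h, h.ne']
      · simp [← h]
      · simp [h.ne, not_lt.2 h.le]
    have ht' : ∀ i, 0 ≤ (if inner ℝ (a i) u = 0 then t i else if 0 < inner ℝ (a i) u then 1 else 0)
        ∧ (if inner ℝ (a i) u = 0 then t i else if 0 < inner ℝ (a i) u then 1 else 0) ≤ 1 := by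
      intro i
      split_ifs
      · exact ht i
      · simp
      · simp
    simp only [key]
    refine ⟨⟨_, ht', rfl⟩, (inner_eq_zonotopeSupport_iff a ht' u).2 fun i => ⟨fun h => ?_,
      fun h => ?_⟩⟩
    · simp [h, h.ne']
    · simp [h.ne, not_lt.2 h.le]

open scoped Pointwise in
theorem vectorSpan_zonotopeFace (u : E) : vectorSpan ℝ (zonotopeFace a u) = orthSpan a u := by
  obtain ⟨c, hc⟩ := exists_zonotopeFace_eq_image a u
  rw [hc, ← span_range_faceGenerator, ← vectorSpan_zonotopeOf]
  have : (fun x => x + c) '' zonotopeOf (faceGenerator a u) =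
      c +ᵥ zonotopeOf (faceGenerator a u) := by
    simp only [add_comm _ c]; rfl
  rw [this, vectorSpan_vadd]

end Zonotope

/-! ### Adding one generator. -/

section Expansion

variable {E : Type*} [AddCommGroup E] [Module ℝ E] {n : ℕ} (e : Module.Basis (Fin n) ℝ E)

theorem absDet_cons_cons_self (p : E) (s : Multiset E) : absDet e (p ::ₘ p ::ₘ s) = 0 := by
  by_cases hs : s.card + 2 = n
  · subst hs
    obtain ⟨f, hf⟩ := exists_map_univ_eq (s := s) rfl
    have h1 := absDet_map e (Fin.cons p (Fin.cons p f))
    rw [map_univ_cons, map_univ_cons, hf] at h1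
    rw [h1, e.det.map_eq_zero_of_eq _ (i := 0) (j := 1) rfl (by simp), abs_zero]
  · exact absDet_of_card_ne e (by simpa using hs)

theorem absDet_map_linearMap (g : E →ₗ[ℝ] E) (s : Multiset E) :
    absDet e (s.map g) = |LinearMap.det g| * absDet e s := by
  by_cases hs : s.card = n
  · obtain ⟨f, rfl⟩ := exists_map_univ_eq hs
    rw [Multiset.map_map, absDet_map, absDet_map, e.det_comp, abs_mul]
  · rw [absDet_of_card_ne e hs, absDet_of_card_ne e (by simpa using hs), mul_zero]

variable {κ : Type*} [Fintype κ] (a : κ → E) (x : κ → ℝ)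

theorem mixedDet_map_linearMap (g : E →ₗ[ℝ] E) (k : ℕ) (s : Multiset E) :
    mixedDet e (g ∘ a) x k (s.map g) = |LinearMap.det g| * mixedDet e a x k s := by
  induction k generalizing s with
  | zero => exact absDet_map_linearMap e g s
  | succ k ih =>
    simp only [mixedDet, Finset.mul_sum]
    refine Finset.sum_congr rfl fun i _ => ?_
    rw [Function.comp_apply, ← Multiset.map_cons, ih]; ring

theorem mixedDet_cons_cons_self (k : ℕ) (p : E) (s : Multiset E) :
    mixedDet e a x k (p ::ₘ p ::ₘ s) = 0 := by
  induction k generalizing s with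
  | zero => exact absDet_cons_cons_self e p s
  | succ k ih =>
    rw [mixedDet]
    refine Finset.sum_eq_zero fun i _ => ?_
    rw [Multiset.cons_swap, Multiset.cons_swap (a i), ih, mul_zero]

theorem mixedDet_zero_cons (k : ℕ) (s : Multiset E) : mixedDet e a x k (0 ::ₘ s) = 0 := by
  induction k generalizing s with
  | zero => simpa [mixedDet] using absDet_cons_smul e 0 0 s
  | succ k ih =>
    rw [mixedDet]
    exact Finset.sum_eq_zero fun i _ => by rw [Multiset.cons_swap, ih, mul_zero]

/-- A repeated vector kills the determinant, so `p` fills at most one of the `m` slots. -/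
theorem mixedDet_cons {k : ℕ} (a : Fin k → E) (p : E) (m : ℕ) (s : Multiset E) :
    mixedDet e (Fin.cons p a : Fin (k + 1) → E) 1 m s =
      mixedDet e a 1 m s + m * mixedDet e a 1 (m - 1) (p ::ₘ s) := by
  induction m generalizing s with
  | zero => simp [mixedDet]
  | succ m ih =>
    simp only [mixedDet, Fin.sum_univ_succ, Fin.cons_zero, Fin.cons_succ, ih, Pi.one_apply,
      one_mul, mixedDet_cons_cons_self, Finset.sum_add_distrib, mul_zero,
      Nat.add_sub_cancel]
    have : ∑ i, (m : ℝ) * mixedDet e a 1 (m - 1) (p ::ₘ a i ::ₘ s) =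
        m * mixedDet e a 1 m (p ::ₘ s) := by
      cases m with
      | zero => simp
      | succ m =>
        rw [← Finset.mul_sum]
        simp only [mixedDet, Nat.add_sub_cancel, Pi.one_apply, one_mul]
        congr 1
        exact Finset.sum_congr rfl fun i _ => by rw [Multiset.cons_swap]
    rw [this]
    push_cast
    ring

theorem zonotopeOf_cons {k : ℕ} (a : Fin k → E) (p : E) :
    zonotopeOf (Fin.cons p a : Fin (k + 1) → E) =
      {y | ∃ x ∈ zonotopeOf a, ∃ t ∈ Set.Icc (0 : ℝ) 1, y = x + t • p} := by
  ext y
  constructor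
  · rintro ⟨t, ht, rfl⟩
    refine ⟨_, ⟨fun i => t i.succ, fun i => ht _, rfl⟩, t 0, ht 0, ?_⟩
    simp [Fin.sum_univ_succ, add_comm]
  · rintro ⟨_, ⟨t, ht, rfl⟩, r, hr, rfl⟩
    refine ⟨Fin.cons r t, fun i => ?_, ?_⟩
    · refine Fin.cases ?_ (fun i => ?_) i
      · simpa using hr
      · simpa using ht i
    · simp [Fin.sum_univ_succ, add_comm]

theorem image_zonotopeOf {F : Type*} [AddCommGroup F] [Module ℝ F] (g : E →ₗ[ℝ] F) :
    g '' zonotopeOf a = zonotopeOf (g ∘ a) := by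
  ext y
  constructor
  · rintro ⟨_, ⟨t, ht, rfl⟩, rfl⟩
    exact ⟨t, ht, by simp⟩
  · rintro ⟨t, ht, rfl⟩
    exact ⟨_, ⟨t, ht, rfl⟩, by simp⟩

end Expansion

/-! ### The volume of a zonotope. -/

section Volume

open MeasureTheory

/-- Forgetting the first coordinate. -/
def tailLinearMap (m : ℕ) : (Fin (m + 1) → ℝ) →ₗ[ℝ] (Fin m → ℝ) :=
  LinearMap.funLeft ℝ ℝ Fin.succ

/-- Laplace expansion along the first row: fixing the first basis vector amounts to projecting along
it. -/
theorem absDet_single_zero_cons (m : ℕ) (s : Multiset (Fin (m + 1) → ℝ)) :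
    absDet (Pi.basisFun ℝ (Fin (m + 1))) (Pi.single 0 1 ::ₘ s) =
      absDet (Pi.basisFun ℝ (Fin m)) (s.map (tailLinearMap m)) := by
  by_cases hs : s.card = m
  · obtain ⟨f, rfl⟩ := exists_map_univ_eq hs
    rw [← map_univ_cons, Multiset.map_map, absDet_map, absDet_map, Pi.basisFun_det_apply,
      Pi.basisFun_det_apply, Matrix.det_succ_row_zero, Fin.sum_univ_succ]
    simp [Matrix.submatrix, tailLinearMap, LinearMap.funLeft]
    rfl
  · rw [absDet_of_card_ne _ (by simpa using hs), absDet_of_card_ne _ (by simpa using hs)]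

theorem mixedDet_single_zero_cons {κ : Type*} [Fintype κ] {m : ℕ} (a : κ → Fin (m + 1) → ℝ)
    (x : κ → ℝ) (k : ℕ) (s : Multiset (Fin (m + 1) → ℝ)) :
    mixedDet (Pi.basisFun ℝ (Fin (m + 1))) a x k (Pi.single 0 1 ::ₘ s) =
      mixedDet (Pi.basisFun ℝ (Fin m)) (tailLinearMap m ∘ a) x k (s.map (tailLinearMap m)) := by
  induction k generalizing s with
  | zero => exact absDet_single_zero_cons m s
  | succ k ih =>
    simp only [mixedDet]
    refine Finset.sum_congr rfl fun i _ => ?_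
    rw [Multiset.cons_swap, ih, Multiset.map_cons]; rfl

theorem volume_add_Icc {K : Set ℝ} (hK : IsCompact K) (hconv : Convex ℝ K) (hne : K.Nonempty) :
    volume {y | ∃ x ∈ K, ∃ t ∈ Set.Icc (0 : ℝ) 1, y = x + t} = volume K + 1 := by
  have h1 := eq_Icc_of_connected_compact ⟨hne, hconv.isPreconnected⟩ hK
  set α := sInf K
  set β := sSup K
  have hαβ : α ≤ β := by
    rw [h1] at hne
    exact Set.nonempty_Icc.1 hne
  have h2 : {y | ∃ x ∈ K, ∃ t ∈ Set.Icc (0 : ℝ) 1, y = x + t} = Set.Icc α (β + 1) := by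
    rw [h1]
    ext y
    constructor
    · rintro ⟨x, hx, t, ht, rfl⟩
      exact ⟨by linarith [hx.1, ht.1], by linarith [hx.2, ht.2]⟩
    · rintro ⟨ha, hb⟩
      refine ⟨min y β, ⟨le_min ha hαβ, min_le_right _ _⟩, y - min y β, ⟨?_, ?_⟩, by ring⟩
      · linarith [min_le_left y β]
      · rcases le_total y β with h | h
        · rw [min_eq_left h]; linarith
        · rw [min_eq_right h]; linarith
  rw [h2, h1, Real.volume_Icc, Real.volume_Icc, ← ENNReal.ofReal_one,
    ← ENNReal.ofReal_add (by linarith) zero_le_one]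
  congr 1
  ring

theorem volume_eq_lintegral_slice {m : ℕ} {S : Set (Fin (m + 1) → ℝ)} (hS : MeasurableSet S) :
    volume S = ∫⁻ y : Fin m → ℝ, volume {s : ℝ | (Fin.cons s y : Fin (m + 1) → ℝ) ∈ S} := by
  have h1 := (volume_preserving_piFinSuccAbove (fun _ : Fin (m + 1) => ℝ) 0).symm
  rw [← h1.measure_preimage hS.nullMeasurableSet, Measure.volume_eq_prod,
    Measure.prod_apply_symm (h1.measurable hS)]
  refine lintegral_congr fun y => ?_
  congr 1
  ext s
  simp [MeasurableEquiv.piFinSuccAbove, Fin.insertNthEquiv]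

/-- Adding a unit segment in the direction of the first coordinate to a convex body increases its
volume by the volume of its projection along that segment. -/
theorem volume_add_segment {m : ℕ} {K : Set (Fin (m + 1) → ℝ)} (hK : IsCompact K)
    (hconv : Convex ℝ K) :
    volume {y | ∃ x ∈ K, ∃ t ∈ Set.Icc (0 : ℝ) 1, y = x + t • Pi.single 0 1} =
      volume K + volume (tailLinearMap m '' K) := by
  set S := {y | ∃ x ∈ K, ∃ t ∈ Set.Icc (0 : ℝ) 1, y = x + t • (Pi.single 0 1 : Fin (m + 1) → ℝ)}
    with hS
  have hScomp : IsCompact S := by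
    have : S = (fun z : (Fin (m + 1) → ℝ) × ℝ => z.1 + z.2 • (Pi.single 0 1 : Fin (m + 1) → ℝ)) ''
        (K ×ˢ Set.Icc 0 1) := by
      ext y
      simp only [hS, Set.mem_ofPred_eq, Set.mem_image, Set.mem_prod, Prod.exists]
      constructor
      · rintro ⟨x, hx, t, ht, rfl⟩; exact ⟨x, t, ⟨hx, ht⟩, rfl⟩
      · rintro ⟨x, t, ⟨hx, ht⟩, rfl⟩; exact ⟨x, hx, t, ht, rfl⟩
    rw [this]
    exact (hK.prod isCompact_Icc).image (by fun_prop)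
  have htail : MeasurableSet (tailLinearMap m '' K) :=
    (hK.image (tailLinearMap m).continuous_of_finiteDimensional).measurableSet
  rw [volume_eq_lintegral_slice hScomp.measurableSet,
    volume_eq_lintegral_slice hK.measurableSet, ← lintegral_indicator_one htail,
    ← lintegral_add_right _ (measurable_one.indicator htail)]
  refine lintegral_congr fun y => ?_
  set Ky := {s : ℝ | (Fin.cons s y : Fin (m + 1) → ℝ) ∈ K} with hKy
  have hcons : ∀ s t : ℝ, (Fin.cons s y : Fin (m + 1) → ℝ) + t • (Pi.single 0 1) =
      Fin.cons (s + t) y := by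
    intro s t
    ext i
    refine Fin.cases ?_ (fun i => ?_) i <;> simp
  have hslice : {s : ℝ | (Fin.cons s y : Fin (m + 1) → ℝ) ∈ S} =
      {r | ∃ x ∈ Ky, ∃ t ∈ Set.Icc (0 : ℝ) 1, r = x + t} := by
    ext r
    constructor
    · rintro ⟨x, hx, t, ht, h⟩
      have hx' : x = Fin.cons (r - t) y := by
        rw [sub_eq_add_neg, ← hcons, h]; simp
      exact ⟨r - t, by rw [hKy, Set.mem_ofPred_eq, ← hx']; exact hx, t, ht, by ring⟩
    · rintro ⟨x, hx, t, ht, rfl⟩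
      exact ⟨_, hx, t, ht, (hcons x t).symm⟩
  rw [hslice]
  have hmem : y ∈ tailLinearMap m '' K ↔ Ky.Nonempty := by
    constructor
    · rintro ⟨z, hz, rfl⟩
      refine ⟨z 0, ?_⟩
      have : (Fin.cons (z 0) (tailLinearMap m z) : Fin (m + 1) → ℝ) = z := Fin.cons_self_tail z
      rwa [hKy, Set.mem_ofPred_eq, this]
    · rintro ⟨s, hs⟩
      exact ⟨_, hs, by ext i; simp [tailLinearMap, LinearMap.funLeft]⟩
  by_cases hne : Ky.Nonempty
  · have hKyc : IsCompact Ky := by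
      refine (hK.image (f := fun z : Fin (m + 1) → ℝ => z 0) (by fun_prop)).of_isClosed_subset
        (hK.isClosed.preimage (f := fun s : ℝ => (Fin.cons s y : Fin (m + 1) → ℝ)) (by fun_prop))
        fun s hs => ⟨_, hs, by simp⟩
    have hKyconv : Convex ℝ Ky := by
      intro s hs s' hs' α β hα hβ hαβ
      have := hconv hs hs' hα hβ hαβ
      have h2 : α • (Fin.cons s y : Fin (m + 1) → ℝ) + β • (Fin.cons s' y : Fin (m + 1) → ℝ) =
          Fin.cons (α • s + β • s') y := by
        ext i
        refine Fin.cases ?_ (fun i => ?_) i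
        · simp
        · simp [← add_mul, hαβ]
      rw [h2] at this
      exact this
    rw [volume_add_Icc hKyc hKyconv hne, Set.indicator_of_mem (hmem.2 hne), Pi.one_apply]
  · have h0 : Ky = ∅ := Set.not_nonempty_iff_eq_empty.1 hne
    rw [Set.indicator_of_notMem (fun h => hne (hmem.1 h)), h0]
    simp

/-- The volume of a zonotope is the sum of the absolute values of the determinants of its
generators. -/
theorem volume_zonotopeOf {k n : ℕ} (a : Fin k → Fin n → ℝ) :
    volume (zonotopeOf a) =
      ENNReal.ofReal (mixedDet (Pi.basisFun ℝ (Fin n)) a 1 n 0 / n.factorial) := by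
  induction k generalizing n with
  | zero =>
    have hz : zonotopeOf a = {0} := by
      ext x; simp [zonotopeOf]
    rw [hz]
    cases n with
    | zero =>
      have h1 : absDet (Pi.basisFun ℝ (Fin 0)) 0 = 1 := by
        have := absDet_map (Pi.basisFun ℝ (Fin 0)) Fin.elim0
        simpa using this
      have h2 : volume ({0} : Set (Fin 0 → ℝ)) = 1 := by
        rw [volume_pi, Measure.pi_of_empty _ 0]; simp
      rw [h2]
      simp [mixedDet, h1]
    | succ n => simp [mixedDet]
  | succ k ih =>
    obtain ⟨p, a, rfl⟩ : ∃ p b, a = Fin.cons p b := ⟨a 0, Fin.tail a, (Fin.cons_self_tail a).symm⟩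
    by_cases hp : p = 0
    · subst hp
      have h1 : zonotopeOf (Fin.cons 0 a : Fin (k + 1) → Fin n → ℝ) = zonotopeOf a := by
        rw [zonotopeOf_cons]
        ext y
        constructor
        · rintro ⟨x, hx, t, -, rfl⟩; simpa using hx
        · intro hy; exact ⟨y, hy, 0, by simp, by simp⟩
      have h2 : ∀ (m : ℕ) (s : Multiset (Fin n → ℝ)),
          mixedDet (Pi.basisFun ℝ (Fin n)) (Fin.cons 0 a : Fin (k + 1) → Fin n → ℝ) 1 m s =
            mixedDet (Pi.basisFun ℝ (Fin n)) a 1 m s := by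
        intro m s
        rw [mixedDet_cons, mixedDet_zero_cons, mul_zero, add_zero]
      rw [h1, h2, ih]
    · obtain ⟨m, rfl⟩ : ∃ m, n = m + 1 := by
        cases n with
        | zero => exact absurd (Subsingleton.elim _ _) hp
        | succ m => exact ⟨m, rfl⟩
      have hone : (Pi.single 0 1 : Fin (m + 1) → ℝ) ≠ 0 := by simp
      -- A linear change of variables sends `p` to the first basis vector. Adding that segment then
      -- adds the volume of a projection, itself a zonotope in one dimension less, as
      -- `mixedDet_cons` predicts.
      obtain ⟨g, hg⟩ := SeparatingDual.exists_continuousLinearEquiv_apply_eq (R := ℝ) hp hone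
      set δ := |LinearMap.det (g : (Fin (m + 1) → ℝ) →ₗ[ℝ] (Fin (m + 1) → ℝ))| with hδ
      have hδ0 : 0 < δ := abs_pos.2 (LinearEquiv.isUnit_det' g.toLinearEquiv).ne_zero
      have hgz : ∀ {j : ℕ} (b : Fin j → Fin (m + 1) → ℝ),
          volume (zonotopeOf (g ∘ b)) = ENNReal.ofReal δ * volume (zonotopeOf b) := by
        intro j b
        rw [← Measure.addHaar_image_continuousLinearEquiv]
        exact congrArg volume (image_zonotopeOf b
          (g : (Fin (m + 1) → ℝ) →ₗ[ℝ] (Fin (m + 1) → ℝ))).symm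
      have hcomp : g ∘ (Fin.cons p a : Fin (k + 1) → Fin (m + 1) → ℝ) =
          Fin.cons (Pi.single 0 1) (g ∘ a) := by
        ext i
        refine Fin.cases ?_ (fun i => ?_) i <;> simp [hg]
      have hmix : mixedDet (Pi.basisFun ℝ (Fin m)) (tailLinearMap m ∘ (g ∘ a)) 1 m 0 =
          δ * mixedDet (Pi.basisFun ℝ (Fin (m + 1))) a 1 m {p} := by
        have h1 := mixedDet_single_zero_cons (g ∘ a) 1 m 0
        have h2 := mixedDet_map_linearMap (Pi.basisFun ℝ (Fin (m + 1))) a 1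
          (g : (Fin (m + 1) → ℝ) →ₗ[ℝ] (Fin (m + 1) → ℝ)) m {p}
        rw [Multiset.map_zero] at h1
        rw [← h1, hδ, ← h2]
        simp [hg]
      have hvol := hgz (Fin.cons p a : Fin (k + 1) → Fin (m + 1) → ℝ)
      rw [hcomp, zonotopeOf_cons, volume_add_segment (isCompact_zonotopeOf _)
        (convex_zonotopeOf _), image_zonotopeOf, hgz, ih, ih, hmix, mul_div_assoc,
        ENNReal.ofReal_mul hδ0.le, ← mul_add] at hvol
      have hnn : ∀ (j : ℕ) (s : Multiset (Fin (m + 1) → ℝ)),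
          0 ≤ mixedDet (Pi.basisFun ℝ (Fin (m + 1))) a 1 j s := fun j s =>
        mixedDet_nonneg _ _ _ (fun _ => zero_le_one) _ _
      have hcancel := (ENNReal.mul_right_inj (by simpa using hδ0) ENNReal.ofReal_ne_top).1 hvol
      rw [← hcancel, ← ENNReal.ofReal_add (div_nonneg (hnn _ _) (by positivity))
        (div_nonneg (hnn _ _) (by positivity)), mixedDet_cons]
      congr 1
      have hfac : ((m + 1).factorial : ℝ) = (m + 1) * m.factorial := by
        rw [Nat.factorial_succ]; push_cast; ring
      have hm0 : (m.factorial : ℝ) ≠ 0 := by positivity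
      have hm1 : (m + 1 : ℝ) ≠ 0 := by positivity
      rw [hfac]
      simp only [Nat.add_sub_cancel, Nat.cast_add, Nat.cast_one]
      have : (p ::ₘ (0 : Multiset (Fin (m + 1) → ℝ))) = {p} := rfl
      rw [this]
      field_simp

end Volume

/-! ### Invariance under linear equivalences. -/

section Transfer

variable {E F : Type*} [AddCommGroup E] [Module ℝ E] [AddCommGroup F] [Module ℝ F] {n : ℕ}
variable (e : Module.Basis (Fin n) ℝ E) (L : E ≃ₗ[ℝ] F)

theorem absDet_map_linearEquiv (s : Multiset E) : absDet (e.map L) (s.map L) = absDet e s := by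
  by_cases hs : s.card = n
  · obtain ⟨f, rfl⟩ := exists_map_univ_eq hs
    rw [Multiset.map_map, absDet_map, absDet_map, Module.Basis.det_map]
    congr 2
    funext i
    simp
  · rw [absDet_of_card_ne e hs, absDet_of_card_ne _ (by simpa using hs)]

theorem mixedDet_map_linearEquiv {κ : Type*} [Fintype κ] (a : κ → E) (x : κ → ℝ) (k : ℕ)
    (s : Multiset E) : mixedDet (e.map L) (L ∘ a) x k (s.map L) = mixedDet e a x k s := by
  induction k generalizing s with
  | zero => exact absDet_map_linearEquiv e L s
  | succ k ih =>
    simp only [mixedDet]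
    refine Finset.sum_congr rfl fun i _ => ?_
    rw [Function.comp_apply, ← Multiset.map_cons, ih]

end Transfer

/-! ### Volume and Hausdorff measure in Euclidean space. -/

section Euclidean

open MeasureTheory

/-- The standard basis of Euclidean space. -/
noncomputable def euclideanBasis (n : ℕ) : Module.Basis (Fin n) ℝ (EuclideanSpace ℝ (Fin n)) :=
  (Pi.basisFun ℝ (Fin n)).map (WithLp.linearEquiv 2 ℝ (Fin n → ℝ)).symm

theorem volume_zonotopeOf_euclidean {k n : ℕ} (a : Fin k → EuclideanSpace ℝ (Fin n)) :
    volume (zonotopeOf a) =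
      ENNReal.ofReal (mixedDet (euclideanBasis n) a 1 n 0 / n.factorial) := by
  set L := WithLp.linearEquiv 2 ℝ (Fin n → ℝ) with hL
  have h1 : (euclideanBasis n).map L = Pi.basisFun ℝ (Fin n) := by
    ext i j; simp [euclideanBasis, hL, Pi.single_apply]
  have h2 := mixedDet_map_linearEquiv (euclideanBasis n) L a 1 n 0
  rw [h1, Multiset.map_zero] at h2
  rw [← h2, ← volume_zonotopeOf]
  have h3 : zonotopeOf (L ∘ a) = L '' zonotopeOf a :=
    (image_zonotopeOf a (L : EuclideanSpace ℝ (Fin n) →ₗ[ℝ] (Fin n → ℝ))).symm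
  have h4 : zonotopeOf a = WithLp.ofLp ⁻¹' zonotopeOf (L ∘ a) := by
    rw [h3]
    exact (Set.preimage_image_eq _ L.injective).symm
  rw [h4]
  exact (PiLp.volume_preserving_ofLp (Fin n)).measure_preimage
    (isCompact_zonotopeOf _).measurableSet.nullMeasurableSet

/-- The volume of a prism of height one over a compact subset of a hyperplane. -/
theorem volume_prism {m : ℕ} {F : Set (EuclideanSpace ℝ (Fin (m + 1)))} (hF : IsCompact F)
    {u : EuclideanSpace ℝ (Fin (m + 1))} (hu : ‖u‖ = 1) {c : ℝ} (hFc : ∀ x ∈ F, inner ℝ x u = c) :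
    volume {y | ∃ x ∈ F, ∃ t ∈ Set.Icc (0 : ℝ) 1, y = x + t • u} = μHE[m] F := by
  classical
  obtain ⟨b, hb⟩ := Orthonormal.exists_orthonormalBasis_extension_of_card_eq (𝕜 := ℝ)
    (E := EuclideanSpace ℝ (Fin (m + 1))) (ι := Fin (m + 1)) (by simp) (v := fun _ => u)
    (s := {0}) (by
      rw [orthonormal_iff_ite]
      rintro ⟨i, hi⟩ ⟨j, hj⟩
      have : i = j := hi.trans hj.symm
      simp [this, hu])
  have hb0 : b 0 = u := hb 0 rfl
  -- In coordinates whose first axis is `u`, the set `F` lies at height `c`; `J` embeds `ℝ^m`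
  -- isometrically at that height, which identifies the Hausdorff measure of `F` with a Lebesgue
  -- measure.
  let J : EuclideanSpace ℝ (Fin m) → EuclideanSpace ℝ (Fin (m + 1)) := fun y =>
    WithLp.toLp 2 (Fin.cons c y.ofLp)
  have hJ : Isometry J := by
    refine Isometry.of_dist_eq fun y z => ?_
    rw [EuclideanSpace.dist_eq, EuclideanSpace.dist_eq, Fin.sum_univ_succ]
    simp [J]
  set RF := b.repr '' F with hRF
  have hRFc : ∀ z ∈ RF, z.ofLp 0 = c := by
    rintro _ ⟨x, hx, rfl⟩
    rw [b.repr_apply_apply, hb0, real_inner_comm]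
    exact hFc x hx
  set F' := J ⁻¹' RF with hF'
  have hJF : J '' F' = RF := by
    rw [hF', Set.image_preimage_eq_iff]
    intro z hz
    refine ⟨WithLp.toLp 2 fun i => z.ofLp i.succ, ?_⟩
    ext i
    refine Fin.cases ?_ (fun i => ?_) i
    · simp [J, hRFc z hz]
    · simp [J]
  have hRFcomp : IsCompact RF := hF.image b.repr.continuous
  have hF'comp : IsCompact F' := hJ.isClosedEmbedding.isCompact_preimage hRFcomp
  have hμ : μHE[m] F = volume F' := by
    rw [← b.repr.isometry.euclideanHausdorffMeasure_image, ← hRF, ← hJF,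
      hJ.euclideanHausdorffMeasure_image, EuclideanSpace.euclideanHausdorffMeasure_eq_volume]
  set P := {y | ∃ x ∈ F, ∃ t ∈ Set.Icc (0 : ℝ) 1, y = x + t • u} with hP
  have hPcomp : IsCompact P := by
    have : P = (fun z : EuclideanSpace ℝ (Fin (m + 1)) × ℝ => z.1 + z.2 • u) ''
        (F ×ˢ Set.Icc 0 1) := by
      ext y
      constructor
      · rintro ⟨x, hx, t, ht, rfl⟩; exact ⟨(x, t), ⟨hx, ht⟩, rfl⟩
      · rintro ⟨⟨x, t⟩, ⟨hx, ht⟩, rfl⟩; exact ⟨x, hx, t, ht, rfl⟩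
    rw [this]
    exact (hF.prod isCompact_Icc).image (by fun_prop)
  set S : Set (Fin (m + 1) → ℝ) := (fun x => (b.repr x).ofLp) '' P with hS
  have hScomp : IsCompact S := hPcomp.image ((PiLp.continuous_ofLp 2 _).comp b.repr.continuous)
  have hinj : Function.Injective fun x => (b.repr x).ofLp := fun x y h =>
    b.repr.injective (WithLp.ofLp_injective 2 h)
  have hPS : volume P = volume S := by
    have h1 := (PiLp.volume_preserving_ofLp (Fin (m + 1))).comp b.measurePreserving_repr
    rw [← h1.measure_preimage hScomp.measurableSet.nullMeasurableSet]
    congr 1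
    exact (Set.preimage_image_eq _ hinj).symm
  set G : Set (Fin m → ℝ) := WithLp.toLp 2 ⁻¹' F' with hG
  have hGmeas : MeasurableSet G :=
    (PiLp.volume_preserving_toLp (Fin m)).measurable hF'comp.measurableSet
  have hGF : volume F' = volume G :=
    ((PiLp.volume_preserving_toLp (Fin m)).measure_preimage
      hF'comp.measurableSet.nullMeasurableSet).symm
  rw [hPS, hμ, hGF, volume_eq_lintegral_slice hScomp.measurableSet,
    ← lintegral_indicator_one hGmeas]
  refine lintegral_congr fun y => ?_
  have hmem : ∀ s : ℝ, (Fin.cons s y : Fin (m + 1) → ℝ) ∈ S ↔ y ∈ G ∧ s ∈ Set.Icc c (c + 1) := by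
    intro s
    constructor
    · rintro ⟨_, ⟨x, hx, t, ht, rfl⟩, h⟩
      have hR : b.repr (x + t • u) = b.repr x + t • EuclideanSpace.single 0 1 := by
        rw [map_add, map_smul, ← hb0, b.repr_self]
      have hx0 := hRFc _ ⟨x, hx, rfl⟩
      have h0 := congrFun h 0
      simp only [hR, WithLp.ofLp_add, WithLp.ofLp_smul, Pi.add_apply, Pi.smul_apply, hx0,
        Fin.cons_zero] at h0
      simp at h0
      refine ⟨?_, by rw [← h0]; exact ⟨by linarith [ht.1], by linarith [ht.2]⟩⟩
      refine ⟨x, hx, ?_⟩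
      ext i
      refine Fin.cases ?_ (fun i => ?_) i
      · simpa [J] using hx0
      · have hi := congrFun h i.succ
        simp only [hR] at hi
        simpa [J] using hi
    · rintro ⟨⟨x, hx, hxJ⟩, hs⟩
      refine ⟨x + (s - c) • u, ⟨x, hx, s - c, ⟨by linarith [hs.1], by linarith [hs.2]⟩, rfl⟩, ?_⟩
      have hR : b.repr (x + (s - c) • u) = b.repr x + (s - c) • EuclideanSpace.single 0 1 := by
        rw [map_add, map_smul, ← hb0, b.repr_self]
      simp only [hR, hxJ]
      ext i
      refine Fin.cases ?_ (fun i => ?_) i <;> simp [J]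
  simp only [hmem]
  by_cases hy : y ∈ G
  · rw [Set.indicator_of_mem hy]
    simp only [hy, true_and]
    change volume (Set.Icc c (c + 1)) = _
    rw [Real.volume_Icc]; simp
  · rw [Set.indicator_of_notMem hy]
    simp [hy]

end Euclidean

/-! ### Volumes of faces. -/

section FaceVolume

open MeasureTheory

theorem mixedDet_eq_zero_of_inner_eq_zero {E : Type*} [NormedAddCommGroup E]
    [InnerProductSpace ℝ E] {n : ℕ} (e : Module.Basis (Fin n) ℝ E) {κ : Type*} [Fintype κ]
    {a : κ → E} {u : E} (hu : u ≠ 0) (ha : ∀ i, inner ℝ (a i) u = 0) (x : κ → ℝ) {k : ℕ}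
    {s : Multiset E} (hs : s.card + k = n) (h : ∀ p ∈ s, inner ℝ p u = 0) :
    mixedDet e a x k s = 0 := by
  induction k generalizing s with
  | zero => exact absDet_eq_zero_of_inner_eq_zero e hs hu h
  | succ k ih =>
    rw [mixedDet]
    refine Finset.sum_eq_zero fun i _ => ?_
    rw [ih (by simp; omega) fun p hp => ?_, mul_zero]
    rcases Multiset.mem_cons.1 hp with rfl | hp
    · exact ha i
    · exact h p hp

/-- The volume of the face in direction `u`, up to a constant, in terms of determinants. -/
noncomputable def faceDet {n k : ℕ} (a : Fin k → EuclideanSpace ℝ (Fin n))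
    (u : EuclideanSpace ℝ (Fin n)) : ℝ :=
  mixedDet (euclideanBasis n) (faceGenerator a u) 1 (n - 1) {u}

theorem faceDet_nonneg {n k : ℕ} (a : Fin k → EuclideanSpace ℝ (Fin n))
    (u : EuclideanSpace ℝ (Fin n)) : 0 ≤ faceDet a u :=
  mixedDet_nonneg _ _ _ (fun _ => zero_le_one) _ _

theorem isCompact_zonotopeFace {E : Type*} [NormedAddCommGroup E] [InnerProductSpace ℝ E]
    {κ : Type*} [Fintype κ] (a : κ → E) (u : E) : IsCompact (zonotopeFace a u) := by
  obtain ⟨c, hc⟩ := exists_zonotopeFace_eq_image a u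
  rw [hc]
  exact (isCompact_zonotopeOf _).image (by fun_prop)

/-- The unit prism over the face is a translated zonotope with the extra generator `u`, and only the
terms of its volume containing `u` survive. -/
theorem euclideanHausdorffMeasure_zonotopeFace {n k : ℕ} (hn : 0 < n)
    (a : Fin k → EuclideanSpace ℝ (Fin n)) {u : EuclideanSpace ℝ (Fin n)} (hu : ‖u‖ = 1) :
    μHE[n - 1] (zonotopeFace a u) = ENNReal.ofReal (n / n.factorial * faceDet a u) := by
  obtain ⟨m, rfl⟩ := Nat.exists_eq_add_of_le' hn
  have hu0 : u ≠ 0 := by rintro rfl; simp at hu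
  rw [Nat.add_sub_cancel, ← volume_prism (isCompact_zonotopeFace a u) hu fun x hx => hx.2]
  obtain ⟨c, hc⟩ := exists_zonotopeFace_eq_image a u
  have h1 : {y | ∃ x ∈ zonotopeFace a u, ∃ t ∈ Set.Icc (0 : ℝ) 1, y = x + t • u} =
      (fun x => x + c) '' zonotopeOf (Fin.cons u (faceGenerator a u) : Fin (k + 1) → _) := by
    rw [zonotopeOf_cons, hc]
    ext y
    constructor
    · rintro ⟨_, ⟨x, hx, rfl⟩, t, ht, rfl⟩
      exact ⟨_, ⟨x, hx, t, ht, rfl⟩, by dsimp only; abel⟩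
    · rintro ⟨_, ⟨x, hx, t, ht, rfl⟩, rfl⟩
      exact ⟨_, ⟨x, hx, rfl⟩, t, ht, by dsimp only; abel⟩
  rw [h1, Set.image_add_right, measure_preimage_add_right, volume_zonotopeOf_euclidean,
    mixedDet_cons, mixedDet_eq_zero_of_inner_eq_zero _ hu0 (inner_faceGenerator a u) 1 (by simp)
      (by simp), zero_add]
  congr 1
  rw [faceDet, mul_comm, div_mul_eq_mul_div, mul_comm]
  congr 1

end FaceVolume

/-! ### Cauchy's projection formula. -/

section Cauchy

variable {E : Type*} [NormedAddCommGroup E] [InnerProductSpace ℝ E]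
variable {n : ℕ} (e : Module.Basis (Fin n) ℝ E)

theorem exists_unit_normal [FiniteDimensional ℝ E] {s : Multiset E}
    (hs : s.card < Module.finrank ℝ E) : ∃ u : E, ‖u‖ = 1 ∧ ∀ p ∈ s, inner ℝ p u = 0 := by
  set W := Submodule.span ℝ {p | p ∈ s} with hW
  have h1 : Module.finrank ℝ W ≤ s.card := finrank_span_le_card' s
  have h2 := W.finrank_add_finrank_orthogonal
  have h3 : 0 < Module.finrank ℝ (Wᗮ : Submodule ℝ E) := by omega
  have := Module.finrank_pos_iff.1 h3
  obtain ⟨⟨z, hz⟩, hz0⟩ := exists_ne (0 : (Wᗮ : Submodule ℝ E))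
  have hz0' : z ≠ 0 := fun h => hz0 (by ext; exact h)
  refine ⟨‖z‖⁻¹ • z, ?_, fun p hp => ?_⟩
  · rw [norm_smul, norm_inv, norm_norm, inv_mul_cancel₀ (norm_ne_zero_iff.2 hz0')]
  · rw [inner_smul_right, hz p (Submodule.subset_span hp), mul_zero]

/-- A finite symmetric set of unit vectors containing normals of all the hyperplanes spanned by the
vectors `a i`. -/
structure ContainsNormals {κ : Type*} (n : ℕ) (a : κ → E) (U : Finset E) : Prop where
  norm_eq : ∀ u ∈ U, ‖u‖ = 1
  neg_mem : ∀ u ∈ U, -u ∈ U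
  exists_normal : ∀ t : Multiset κ, t.card + 1 = n → ∃ u ∈ U, ∀ p ∈ t.map a, inner ℝ p u = 0

/-- One set must serve both families, so that the two Cauchy sums can be compared term by term. -/
theorem exists_containsNormals [FiniteDimensional ℝ E] (hE : Module.finrank ℝ E = n)
    {κ κ' : Type*} [Fintype κ] [Fintype κ'] (a : κ → E) (b : κ' → E) :
    ∃ U : Finset E, ContainsNormals n a U ∧ ContainsNormals n b U := by
  classical
  by_cases hn : n = 0
  · exact ⟨∅, ⟨by simp, by simp, fun t ht => by omega⟩, ⟨by simp, by simp, fun t ht => by omega⟩⟩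
  have key : ∀ s : Fin (n - 1) → E, ∃ u : E, ‖u‖ = 1 ∧ ∀ i, inner ℝ (s i) u = 0 := by
    intro s
    obtain ⟨u, hu, h⟩ := exists_unit_normal (s := Finset.univ.val.map s) (by
      rw [hE, Multiset.card_map, Finset.card_val, Finset.card_univ, Fintype.card_fin]; omega)
    exact ⟨u, hu, fun i => h _ (by simp)⟩
  choose N hN1 hN2 using key
  set U₀ : Finset E := Finset.univ.image (fun f : Fin (n - 1) → κ => N (a ∘ f)) ∪
    Finset.univ.image (fun f : Fin (n - 1) → κ' => N (b ∘ f)) with hU₀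
  have hU₀1 : ∀ u ∈ U₀, ‖u‖ = 1 := by
    intro u hu
    simp only [hU₀, Finset.mem_union, Finset.mem_image, Finset.mem_univ, true_and] at hu
    rcases hu with ⟨f, rfl⟩ | ⟨f, rfl⟩ <;> exact hN1 _
  have hsub : U₀ ⊆ U₀ ∪ U₀.image Neg.neg := Finset.subset_union_left
  have h1 : ∀ u ∈ U₀ ∪ U₀.image Neg.neg, ‖u‖ = 1 := by
    intro u hu
    rcases Finset.mem_union.1 hu with h | h
    · exact hU₀1 u h
    · obtain ⟨w, hw, rfl⟩ := Finset.mem_image.1 h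
      rw [norm_neg, hU₀1 w hw]
  have h2 : ∀ u ∈ U₀ ∪ U₀.image Neg.neg, -u ∈ U₀ ∪ U₀.image Neg.neg := by
    intro u hu
    rcases Finset.mem_union.1 hu with h | h
    · exact Finset.mem_union_right _ (Finset.mem_image_of_mem _ h)
    · obtain ⟨w, hw, rfl⟩ := Finset.mem_image.1 h
      rw [neg_neg]; exact hsub hw
  refine ⟨U₀ ∪ U₀.image Neg.neg, ⟨h1, h2, fun t ht => ?_⟩, ⟨h1, h2, fun t ht => ?_⟩⟩
  · obtain ⟨f, rfl⟩ := exists_map_univ_eq (s := t) (n := n - 1) (by omega)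
    refine ⟨N (a ∘ f), hsub (Finset.mem_union_left _ (Finset.mem_image_of_mem _
      (Finset.mem_univ f))), fun p hp => ?_⟩
    simp only [Multiset.map_map, Multiset.mem_map] at hp
    obtain ⟨i, -, rfl⟩ := hp
    exact hN2 (a ∘ f) i
  · obtain ⟨f, rfl⟩ := exists_map_univ_eq (s := t) (n := n - 1) (by omega)
    refine ⟨N (b ∘ f), hsub (Finset.mem_union_right _ (Finset.mem_image_of_mem _
      (Finset.mem_univ f))), fun p hp => ?_⟩
    simp only [Multiset.map_map, Multiset.mem_map] at hp
    obtain ⟨i, -, rfl⟩ := hp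
    exact hN2 (b ∘ f) i

variable {κ : Type*} {a : κ → E} {U : Finset E}

-- If the vectors of `t` are independent, their only unit normals are `N` and `-N`, each
-- contributing once; this is the factor `2`. If they are dependent, every determinant involved
-- vanishes, however many normals `U` contains.
open Classical in
theorem two_mul_absDet_cons (hU : ContainsNormals n a U) {t : Multiset κ} (ht : t.card + 1 = n)
    (w : E) : 2 * absDet e (w ::ₘ t.map a) =
      ∑ u ∈ U, if ∀ p ∈ t.map a, inner ℝ p u = 0 then
        |inner ℝ w u| * absDet e (u ::ₘ t.map a) else 0 := by
  obtain ⟨N, hNU, hN⟩ := hU.exists_normal t ht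
  have hN1 := hU.norm_eq N hNU
  have hcard : (t.map a).card + 1 = n := by simpa using ht
  rw [absDet_cons_of_inner_eq_zero e hcard hN1 hN]
  by_cases h0 : absDet e (N ::ₘ t.map a) = 0
  · rw [h0, mul_zero, mul_zero]
    refine (Finset.sum_eq_zero fun u _ => ?_).symm
    rw [absDet_cons_of_inner_eq_zero e hcard hN1 hN, h0]
    simp
  have hne : N ≠ -N := by
    intro h
    have h1 : N = 0 := by
      have : (2 : ℝ) • N = 0 := by rw [two_smul]; nth_rewrite 2 [h]; simp
      exact (smul_eq_zero.1 this).resolve_left two_ne_zero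
    rw [h1] at hN1; simp at hN1
  have hsub : ({N, -N} : Finset E) ⊆ U := by
    intro u hu
    rcases Finset.mem_insert.1 hu with rfl | hu
    · exact hNU
    · rw [Finset.mem_singleton.1 hu]; exact hU.neg_mem N hNU
  rw [← Finset.sum_subset hsub fun u hu hu' => ?_, Finset.sum_pair hne, if_pos hN, if_pos]
  · have : absDet e (-N ::ₘ t.map a) = absDet e (N ::ₘ t.map a) := by
      rw [← neg_one_smul ℝ N, absDet_cons_smul]; simp
    rw [this, inner_neg_right, abs_neg]; ring
  · intro p hp
    rw [inner_neg_right, hN p hp, neg_zero]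
  · refine if_neg fun hall => hu' ?_
    have hu1 := hU.norm_eq u hu
    have h1 := absDet_cons_of_inner_eq_zero e hcard hN1 hN u
    have h2 := absDet_cons_of_inner_eq_zero e hcard hu1 hall N
    rw [h1, real_inner_comm u N, ← mul_assoc] at h2
    have h3 : |inner ℝ u N| * |inner ℝ u N| = 1 :=
      mul_right_cancel₀ h0 (by rw [one_mul]; exact h2.symm)
    rw [abs_mul_abs_self] at h3
    rcases mul_self_eq_one_iff.1 h3 with h | h
    · rw [inner_eq_one_iff_of_norm_eq_one hu1 hN1] at h
      simp [h]
    · rw [inner_eq_neg_one_iff_of_norm_eq_one hu1 hN1] at h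
      simp [h]

open Classical in
/-- Cauchy's projection formula for zonotopes. -/
theorem two_mul_mixedDet_cons [Fintype κ] (hU : ContainsNormals n a U) {k : ℕ} {t : Multiset κ}
    (ht : t.card + k + 1 = n) (w : E) :
    2 * mixedDet e a 1 k (w ::ₘ t.map a) =
      ∑ u ∈ U, if ∀ p ∈ t.map a, inner ℝ p u = 0 then
        |inner ℝ w u| * mixedDet e (faceGenerator a u) 1 k (u ::ₘ t.map a) else 0 := by
  induction k generalizing t with
  | zero => exact two_mul_absDet_cons e hU ht w
  | succ k ih =>
    simp only [mixedDet, Pi.one_apply, one_mul, Finset.mul_sum]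
    have h1 := fun i => ih (t := i ::ₘ t) (by simp; omega)
    have h2 : ∀ i, a i ::ₘ w ::ₘ t.map a = w ::ₘ (i ::ₘ t).map a := fun i => by
      rw [Multiset.cons_swap, Multiset.map_cons]
    simp_rw [h2, h1]
    rw [Finset.sum_comm]
    refine Finset.sum_congr rfl fun u _ => ?_
    by_cases hu : ∀ p ∈ t.map a, inner ℝ p u = 0
    · rw [if_pos hu]
      refine Finset.sum_congr rfl fun i _ => ?_
      -- A generator not orthogonal to `u` fails the condition on one side and is replaced by zero
      -- in `faceGenerator` on the other.
      by_cases hi : inner ℝ (a i) u = 0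
      · rw [if_pos, faceGenerator, if_pos hi, Multiset.map_cons, Multiset.cons_swap]
        intro p hp
        rw [Multiset.map_cons, Multiset.mem_cons] at hp
        rcases hp with rfl | hp
        · exact hi
        · exact hu p hp
      · rw [if_neg fun h => hi (h (a i) (by simp)), faceGenerator, if_neg hi]
        rw [mixedDet_zero_cons, mul_zero]
    · rw [if_neg hu]
      exact Finset.sum_eq_zero fun i _ => if_neg fun h => hu fun p hp => h p (by
        rw [Multiset.map_cons]; exact Multiset.mem_cons_of_mem hp)

end Cauchy

/-! ### Facet volumes determine a zonotope. -/

section Determination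

variable {n k l : ℕ}

theorem mixedDet_eq_of_faceDet_eq (hn : 0 < n) {a : Fin k → EuclideanSpace ℝ (Fin n)}
    {b : Fin l → EuclideanSpace ℝ (Fin n)}
    (h : ∀ u, ‖u‖ = 1 → faceDet a u = faceDet b u) (w : EuclideanSpace ℝ (Fin n)) :
    mixedDet (euclideanBasis n) a 1 (n - 1) {w} = mixedDet (euclideanBasis n) b 1 (n - 1) {w} := by
  classical
  obtain ⟨U, hUa, hUb⟩ := exists_containsNormals (n := n) (by simp) a b
  have h1 := two_mul_mixedDet_cons (euclideanBasis n) hUa (k := n - 1) (t := 0)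
    (by simp; omega) w
  have h2 := two_mul_mixedDet_cons (euclideanBasis n) hUb (k := n - 1) (t := 0)
    (by simp; omega) w
  have h3 : 2 * mixedDet (euclideanBasis n) a 1 (n - 1) {w} =
      2 * mixedDet (euclideanBasis n) b 1 (n - 1) {w} := by
    refine h1.trans (Eq.trans ?_ h2.symm)
    refine Finset.sum_congr rfl fun u hu => ?_
    have := h u (hUa.norm_eq u hu)
    simp only [faceDet] at this
    simp only [Multiset.map_zero, Multiset.cons_zero, this]
    simp
  linarith

/-- A zonotope is determined up to translation by the volumes of its facets. -/
theorem exists_translation_of_faceDet_eq (hn : 2 ≤ n) {a : Fin k → EuclideanSpace ℝ (Fin n)}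
    {b : Fin l → EuclideanSpace ℝ (Fin n)} (ha : Submodule.span ℝ (Set.range a) = ⊤)
    (hb : Submodule.span ℝ (Set.range b) = ⊤)
    (h : ∀ u, ‖u‖ = 1 → faceDet a u = faceDet b u) :
    ∃ c, (fun x => x + c) '' zonotopeOf a = zonotopeOf b := by
  set e := euclideanBasis n
  -- Both zonotopes become weightings of one family. The endpoint weights have zeros, but every
  -- weight is positive inside the segment joining them.
  set v : Fin k ⊕ Fin l → EuclideanSpace ℝ (Fin n) := Sum.elim a b with hv
  set x : Fin k ⊕ Fin l → ℝ := Sum.elim 1 0 with hx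
  set y : Fin k ⊕ Fin l → ℝ := Sum.elim 0 1 with hy
  have hax : ∀ j s, mixedDet e v x j s = mixedDet e a 1 j s := by
    intro j
    induction j with
    | zero => intro s; rfl
    | succ j ih => intro s; simp only [mixedDet, Fintype.sum_sum_type, ih]; simp [hv, hx]
  have hby : ∀ j s, mixedDet e v y j s = mixedDet e b 1 j s := by
    intro j
    induction j with
    | zero => intro s; rfl
    | succ j ih => intro s; simp only [mixedDet, Fintype.sum_sum_type, ih]; simp [hv, hy]
  have hpos : ∀ {m : ℕ} {c : Fin m → EuclideanSpace ℝ (Fin n)},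
      Submodule.span ℝ (Set.range c) = ⊤ → 0 < mixedDet e c 1 n 0 := fun hc => by
    rw [mixedDet_pos_iff e _ 1 (fun _ => zero_lt_one) hc (by simp)]
    have : {q : EuclideanSpace ℝ (Fin n) | q ∈ (0 : Multiset (EuclideanSpace ℝ (Fin n)))} = ∅ := by
      ext; simp
    rw [this, Submodule.span_empty, finrank_bot, Multiset.card_zero]
  have hvspan : Submodule.span ℝ (Set.range v) = ⊤ := by
    rw [eq_top_iff, ← ha]
    exact Submodule.span_mono (by rw [hv, Set.Sum.elim_range]; exact Set.subset_union_left)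
  have h1 : ∀ t : Multiset (Fin k ⊕ Fin l), t.card + 1 = n →
      ∑ j, (y - x) j * absDet e (v j ::ₘ t.map v) = 0 := fun t ht =>
    sum_sub_mul_absDet_eq_zero e v hn (x := x) (y := y)
      (by rintro (i | i) <;> simp [hx]) (by rintro (i | i) <;> simp [hy])
      (by rintro (i | i) <;> simp [hx, hy]) hvspan
      (by rw [hax]; exact hpos ha) (by rw [hby]; exact hpos hb)
      (fun i => by rw [hax, hby]; exact mixedDet_eq_of_faceDet_eq (by omega) h (v i))
      (by omega)
  refine ⟨_, image_add_zonotopeOf a b fun w => ?_⟩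
  have h2 := sum_mul_abs_inner_eq_zero_of_absDet e hvspan h1 w
  simp [hv, hx, hy] at h2
  linarith

end Determination

/-! ### Facets and their normals. -/

section Facets

variable {n k l : ℕ}

theorem isExposed_zonotopeFace (a : Fin k → EuclideanSpace ℝ (Fin n))
    (u : EuclideanSpace ℝ (Fin n)) : IsExposed ℝ (zonotopeOf a) (zonotopeFace a u) := by
  refine fun _ => ⟨innerSL ℝ u, Set.ext fun _ => ?_⟩
  rw [mem_zonotopeFace_iff]
  rfl

theorem exists_eq_zonotopeFace {a : Fin k → EuclideanSpace ℝ (Fin n)}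
    {F : Set (EuclideanSpace ℝ (Fin n))} (hF : IsExposed ℝ (zonotopeOf a) F) (hne : F.Nonempty) :
    ∃ u, F = zonotopeFace a u := by
  obtain ⟨f, hf⟩ := hF hne
  refine ⟨(InnerProductSpace.toDual ℝ _).symm f, ?_⟩
  refine Set.ext fun _ => ?_
  rw [hf, mem_zonotopeFace_iff]
  simp only [InnerProductSpace.toDual_symm_apply]
  rfl

theorem isFacet_zonotopeFace_iff {a : Fin k → EuclideanSpace ℝ (Fin n)}
    (ha : Submodule.span ℝ (Set.range a) = ⊤) (u : EuclideanSpace ℝ (Fin n)) :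
    IsFacet (zonotopeOf a) (zonotopeFace a u) ↔ Module.finrank ℝ (orthSpan a u) + 1 = n := by
  rw [IsFacet, vectorSpan_zonotopeFace, vectorSpan_zonotopeOf, ha, finrank_top,
    finrank_euclideanSpace_fin]
  exact ⟨fun h => h.2.2, fun h => ⟨isExposed_zonotopeFace a u, zonotopeFace_nonempty a u, h⟩⟩

theorem isOutwardUnitNormal_zonotopeFace (a : Fin k → EuclideanSpace ℝ (Fin n))
    {u : EuclideanSpace ℝ (Fin n)} (hu : ‖u‖ = 1) :
    IsOutwardUnitNormal (zonotopeOf a) (zonotopeFace a u) u :=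
  ⟨hu, fun _ hx y hy => ((mem_zonotopeFace_iff a).1 hx).2 y hy⟩

theorem IsOutwardUnitNormal.subset_zonotopeFace {a : Fin k → EuclideanSpace ℝ (Fin n)}
    {F : Set (EuclideanSpace ℝ (Fin n))} {u : EuclideanSpace ℝ (Fin n)}
    (h : IsOutwardUnitNormal (zonotopeOf a) F u) (hF : F ⊆ zonotopeOf a) :
    F ⊆ zonotopeFace a u :=
  fun x hx => (mem_zonotopeFace_iff a).2 ⟨hF hx, fun y hy => h.2 x hx y hy⟩

/-- A nonzero determinant requires the generators of the face, together with `u`, to span the space.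
-/
theorem orthSpan_finrank_of_faceDet_pos {a : Fin k → EuclideanSpace ℝ (Fin n)}
    (hn : 0 < n) {u : EuclideanSpace ℝ (Fin n)} (hu : ‖u‖ = 1) (h : 0 < faceDet a u) :
    Module.finrank ℝ (orthSpan a u) + 1 = n := by
  have hu0 : u ≠ 0 := by rintro rfl; simp at hu
  have h1 : Module.finrank ℝ (ℝ ∙ u) = 1 := finrank_span_singleton hu0
  have h2 := Submodule.finrank_mono (orthSpan_le a u)
  have h3 := (ℝ ∙ u).finrank_add_finrank_orthogonal
  rw [finrank_euclideanSpace_fin] at h3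
  by_contra hne
  have hlt : Module.finrank ℝ (orthSpan a u ⊔ (ℝ ∙ u) : Submodule ℝ _) < n := by
    have := Submodule.finrank_add_le_finrank_add_finrank (orthSpan a u) (ℝ ∙ u)
    omega
  have key : ∀ (m : ℕ) (s : Multiset (EuclideanSpace ℝ (Fin n))),
      (∀ p ∈ s, p ∈ orthSpan a u ⊔ (ℝ ∙ u)) → s.card + m = n →
      mixedDet (euclideanBasis n) (faceGenerator a u) 1 m s = 0 := by
    intro m
    induction m with
    | zero =>
      intro s hs hcard
      by_contra h0
      have h4 := (absDet_pos_iff (euclideanBasis n) hcard).1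
        ((absDet_nonneg _ s).lt_of_ne' h0)
      have h5 : Submodule.span ℝ {p | p ∈ s} ≤ orthSpan a u ⊔ (ℝ ∙ u) :=
        Submodule.span_le.2 fun p hp => hs p hp
      rw [h4, top_le_iff] at h5
      rw [h5, finrank_top, finrank_euclideanSpace_fin] at hlt
      exact hlt.false
    | succ m ih =>
      intro s hs hcard
      rw [mixedDet]
      refine Finset.sum_eq_zero fun i _ => ?_
      rw [ih _ (fun p hp => ?_) (by simp; omega), mul_zero]
      rcases Multiset.mem_cons.1 hp with rfl | hp
      · refine Submodule.mem_sup_left ?_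
        rw [← span_range_faceGenerator]
        exact Submodule.subset_span ⟨i, rfl⟩
      · exact hs p hp
  refine h.ne' (key (n - 1) {u} (fun p hp => ?_) (by simp; omega))
  rw [Multiset.mem_singleton.1 hp]
  exact Submodule.mem_sup_right (Submodule.mem_span_singleton_self u)

theorem faceDet_le_of_measure_le (hn : 0 < n) {a : Fin k → EuclideanSpace ℝ (Fin n)}
    {b : Fin l → EuclideanSpace ℝ (Fin n)} {u : EuclideanSpace ℝ (Fin n)} (hu : ‖u‖ = 1)
    (h : μHE[n - 1] (zonotopeFace a u) ≤ μHE[n - 1] (zonotopeFace b u)) :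
    faceDet a u ≤ faceDet b u := by
  have hc : (0 : ℝ) < n / n.factorial := by positivity
  rw [euclideanHausdorffMeasure_zonotopeFace hn a hu,
    euclideanHausdorffMeasure_zonotopeFace hn b hu,
    ENNReal.ofReal_le_ofReal_iff (mul_nonneg hc.le (faceDet_nonneg b u))] at h
  exact le_of_mul_le_mul_left h hc

/-- A facet has only one outward unit normal. -/
theorem eq_of_zonotopeFace_subset {b : Fin l → EuclideanSpace ℝ (Fin n)}
    (hb : Submodule.span ℝ (Set.range b) = ⊤) {u w : EuclideanSpace ℝ (Fin n)} (hu : ‖u‖ = 1)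
    (hw : ‖w‖ = 1) (hfin : Module.finrank ℝ (orthSpan b u) + 1 = n)
    (h : zonotopeFace b u ⊆ zonotopeFace b w) : w = u := by
  have hu0 : u ≠ 0 := by rintro rfl; simp at hu
  have hw0 : w ≠ 0 := by rintro rfl; simp at hw
  have h1 : orthSpan b u = (ℝ ∙ u)ᗮ := by
    refine Submodule.eq_of_le_of_finrank_eq (orthSpan_le b u) ?_
    have h3 := (ℝ ∙ u).finrank_add_finrank_orthogonal
    rw [finrank_euclideanSpace_fin, finrank_span_singleton hu0] at h3
    omega
  have h2 : orthSpan b u ≤ (ℝ ∙ w)ᗮ := by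
    rw [← vectorSpan_zonotopeFace]
    refine (vectorSpan_mono ℝ h).trans ?_
    rw [vectorSpan_zonotopeFace]
    exact orthSpan_le b w
  have h3 : w ∈ (ℝ ∙ u) := by
    rw [h1, Submodule.orthogonal_le_orthogonal_iff] at h2
    exact h2 (Submodule.mem_span_singleton_self w)
  obtain ⟨c, rfl⟩ := Submodule.mem_span_singleton.1 h3
  rw [norm_smul, hu, mul_one, Real.norm_eq_abs] at hw
  rcases abs_eq (zero_le_one' ℝ) |>.1 hw with rfl | rfl
  · rw [one_smul]
  -- If both `u` and `-u` were maximal on the face, the whole zonotope would lie in a hyperplane.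
  · exfalso
    obtain ⟨x, hx⟩ := zonotopeFace_nonempty b u
    have hx1 := ((mem_zonotopeFace_iff b).1 hx).2
    have hx2 := ((mem_zonotopeFace_iff b).1 (h hx)).2
    obtain ⟨i, hi⟩ := exists_inner_ne_zero_of_span_eq_top hb hu0
    have hc : ∀ y ∈ zonotopeOf b, inner ℝ u y = inner ℝ u x := fun y hy => by
      have := hx2 y hy
      simp only [neg_smul, one_smul, inner_neg_left] at this
      exact le_antisymm (hx1 y hy) (by linarith)
    have h4 := hc _ (zero_mem_zonotopeOf b)
    have h5 := hc _ (mem_zonotopeOf_self b i)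
    rw [inner_zero_right] at h4
    rw [real_inner_comm, h5, ← h4] at hi
    exact hi rfl

end Facets

/-! ### Transfer through the face lattice isomorphism. -/

section Main

variable {n k l : ℕ}

theorem span_range_toLp_col (A : Matrix (Fin n) (Fin k) ℝ) (hA : A.rank = n) :
    Submodule.span ℝ (Set.range fun i => WithLp.toLp 2 (A.col i)) = ⊤ := by
  rw [Matrix.rank_eq_finrank_span_cols] at hA
  have h1 : Submodule.span ℝ (Set.range A.col) = ⊤ :=
    Submodule.eq_top_of_finrank_eq (by rw [hA, Module.finrank_fin_fun])
  let L : (Fin n → ℝ) ≃ₗ[ℝ] EuclideanSpace ℝ (Fin n) := (WithLp.linearEquiv 2 ℝ (Fin n → ℝ)).symm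
  have h2 := congrArg (Submodule.map L.toLinearMap) h1
  rw [Submodule.map_span, Submodule.map_top, LinearEquiv.range, ← Set.range_comp] at h2
  exact h2

theorem orderIso_eq_empty {P Q : Set (EuclideanSpace ℝ (Fin n))} (φ : FaceLattice P ≃o FaceLattice Q)
    {F : FaceLattice P} (hF : (F : Set (EuclideanSpace ℝ (Fin n))) = ∅) :
    (φ F : Set (EuclideanSpace ℝ (Fin n))) = ∅ := by
  have h1 : F ≤ φ.symm ⟨∅, isExposed_empty⟩ := by
    change (F : Set (EuclideanSpace ℝ (Fin n))) ⊆ _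
    rw [hF]; exact Set.empty_subset _
  have h2 : φ F ≤ ⟨∅, isExposed_empty⟩ := by
    rw [← φ.le_symm_apply]; exact h1
  exact Set.subset_empty_iff.1 h2

theorem orderIso_eq_self {P Q : Set (EuclideanSpace ℝ (Fin n))} (φ : FaceLattice P ≃o FaceLattice Q)
    {F : FaceLattice P} (hF : (F : Set (EuclideanSpace ℝ (Fin n))) = P) :
    (φ F : Set (EuclideanSpace ℝ (Fin n))) = Q := by
  have h1 : φ.symm ⟨Q, IsExposed.refl Q⟩ ≤ F := by
    change _ ⊆ (F : Set (EuclideanSpace ℝ (Fin n)))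
    rw [hF]; exact IsExposed.subset (φ.symm ⟨Q, IsExposed.refl Q⟩).2
  have h2 : ⟨Q, IsExposed.refl Q⟩ ≤ φ F := by
    rw [← φ.symm_apply_le]; exact h1
  exact (IsExposed.subset (φ F).2).antisymm h2

theorem zonotopeFace_ne_zonotopeOf {b : Fin l → EuclideanSpace ℝ (Fin n)}
    (hb : Submodule.span ℝ (Set.range b) = ⊤) {u : EuclideanSpace ℝ (Fin n)} (hu : u ≠ 0) :
    zonotopeFace b u ≠ zonotopeOf b := by
  intro h
  obtain ⟨i, hi⟩ := exists_inner_ne_zero_of_span_eq_top hb hu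
  have h1 := (h.symm ▸ zero_mem_zonotopeOf b : (0 : EuclideanSpace ℝ (Fin n)) ∈ zonotopeFace b u).2
  have h2 := (h.symm ▸ mem_zonotopeOf_self b i : b i ∈ zonotopeFace b u).2
  rw [inner_zero_left] at h1
  exact hi (h2.trans h1.symm)

/-- A ray in the closed cone of `w` gives a larger face, and the rank condition on the ray makes
that face a facet. -/
theorem exists_unit_ray {a : Fin k → EuclideanSpace ℝ (Fin n)}
    (ha : Submodule.span ℝ (Set.range a) = ⊤) {w : EuclideanSpace ℝ (Fin n)} (hw : w ≠ 0) :
    ∃ r, ‖r‖ = 1 ∧ zonotopeFace a w ⊆ zonotopeFace a r ∧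
      IsFacet (zonotopeOf a) (zonotopeFace a r) := by
  obtain ⟨r, hr0, hr, hrk⟩ := exists_ray a ha hw
  rw [finrank_euclideanSpace_fin] at hrk
  have hpos : 0 < ‖r‖⁻¹ := inv_pos.2 (norm_pos_iff.2 hr0)
  have hspan : orthSpan a (‖r‖⁻¹ • r) = orthSpan a r := by
    simp only [orthSpan, inner_smul_right, mul_eq_zero, hpos.ne', false_or]
  refine ⟨‖r‖⁻¹ • r, ?_, zonotopeFace_subset a fun i => ?_, ?_⟩
  · rw [norm_smul, norm_inv, norm_norm, inv_mul_cancel₀ (norm_ne_zero_iff.2 hr0)]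
  · rw [inner_smul_right]
    exact ⟨fun h => mul_nonneg hpos.le ((hr i).1 h),
      fun h => mul_nonpos_of_nonneg_of_nonpos hpos.le ((hr i).2 h)⟩
  · rw [isFacet_zonotopeFace_iff ha, hspan]; exact hrk

/-- Zonotopes with corresponding facets of equal volumes have equal facet determinants. -/
theorem faceDet_eq_of_orderIso (hn : 2 ≤ n) {a : Fin k → EuclideanSpace ℝ (Fin n)}
    {b : Fin l → EuclideanSpace ℝ (Fin n)} (ha : Submodule.span ℝ (Set.range a) = ⊤)
    (hb : Submodule.span ℝ (Set.range b) = ⊤)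
    (φ : FaceLattice (zonotopeOf a) ≃o FaceLattice (zonotopeOf b))
    (hnormal : ∀ F : FaceLattice (zonotopeOf a), IsFacet (zonotopeOf a) F →
      ∀ u : EuclideanSpace ℝ (Fin n),
        IsOutwardUnitNormal (zonotopeOf a) F u ↔ IsOutwardUnitNormal (zonotopeOf b) (φ F) u)
    (hvolume : ∀ F : FaceLattice (zonotopeOf a), IsFacet (zonotopeOf a) F →
      μHE[n - 1] (F : Set (EuclideanSpace ℝ (Fin n))) =
        μHE[n - 1] (φ F : Set (EuclideanSpace ℝ (Fin n))))
    {u : EuclideanSpace ℝ (Fin n)} (hu : ‖u‖ = 1) : faceDet a u = faceDet b u := by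
  have hn0 : 0 < n := by omega
  have hu0 : u ≠ 0 := by rintro rfl; simp at hu
  let Fa : EuclideanSpace ℝ (Fin n) → FaceLattice (zonotopeOf a) := fun w =>
    ⟨zonotopeFace a w, isExposed_zonotopeFace a w⟩
  have hsub : ∀ w, ‖w‖ = 1 → IsFacet (zonotopeOf a) (zonotopeFace a w) →
      (φ (Fa w) : Set (EuclideanSpace ℝ (Fin n))) ⊆ zonotopeFace b w := fun w hw hF =>
    ((hnormal (Fa w) hF w).1 (isOutwardUnitNormal_zonotopeFace a hw)).subset_zonotopeFace
      (IsExposed.subset (φ (Fa w)).2)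
  apply le_antisymm
  · rcases (faceDet_nonneg a u).eq_or_lt with h0 | h0
    · rw [← h0]; exact faceDet_nonneg b u
    · have hF := (isFacet_zonotopeFace_iff ha u).2 (orthSpan_finrank_of_faceDet_pos hn0 hu h0)
      refine faceDet_le_of_measure_le hn0 hu ?_
      exact (hvolume (Fa u) hF).le.trans (MeasureTheory.measure_mono (hsub u hu hF))
  · rcases (faceDet_nonneg b u).eq_or_lt with h0 | h0
    · rw [← h0]; exact faceDet_nonneg a u
    · have hfin := orthSpan_finrank_of_faceDet_pos hn0 hu h0
      set G : FaceLattice (zonotopeOf b) := ⟨zonotopeFace b u, isExposed_zonotopeFace b u⟩ with hG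
      have hφF : φ (φ.symm G) = G := φ.apply_symm_apply G
      have hne : (φ.symm G : Set (EuclideanSpace ℝ (Fin n))).Nonempty := by
        by_contra h
        have h1 := orderIso_eq_empty φ (Set.not_nonempty_iff_eq_empty.1 h)
        rw [hφF] at h1
        exact (zonotopeFace_nonempty b u).ne_empty h1
      obtain ⟨w, hw⟩ := exists_eq_zonotopeFace (φ.symm G).2 hne
      have hw0 : w ≠ 0 := by
        rintro rfl
        have h1 : zonotopeFace a 0 = zonotopeOf a := by
          ext x; simp [mem_zonotopeFace_iff]
        have h2 := orderIso_eq_self φ (hw.trans h1)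
        rw [hφF] at h2
        exact zonotopeFace_ne_zonotopeOf hb hu0 h2
      -- The preimage of the facet `G` is not known to be a facet, since dimension is not tracked
      -- through `φ`. It is enlarged to one with normal `r`, whose image contains `G` and lies in
      -- the face of direction `r`; uniqueness of facet normals then gives `r = u`.
      obtain ⟨r, hr, hwr, hF⟩ := exists_unit_ray ha hw0
      have hle : φ.symm G ≤ Fa r := by
        change (φ.symm G : Set (EuclideanSpace ℝ (Fin n))) ⊆ zonotopeFace a r
        rw [hw]; exact hwr
      have hGle : zonotopeFace b u ⊆ (φ (Fa r) : Set (EuclideanSpace ℝ (Fin n))) :=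
        φ.symm_apply_le.1 hle
      obtain rfl := eq_of_zonotopeFace_subset hb hu hr hfin (hGle.trans (hsub r hr hF))
      refine faceDet_le_of_measure_le hn0 hu ?_
      exact (MeasureTheory.measure_mono hGle).trans (hvolume (Fa r) hF).ge

end Main

theorem proposition3p9 {n k l : ℕ} (hn : 2 ≤ n)
    (A : Matrix (Fin n) (Fin k) ℝ) (B : Matrix (Fin n) (Fin l) ℝ)
    (hA : A.rank = n) (hB : B.rank = n)
    (φ : FaceLattice (zonotope A) ≃o FaceLattice (zonotope B))
    (hnormal : ∀ F : FaceLattice (zonotope A), IsFacet (zonotope A) F →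
      ∀ u : EuclideanSpace ℝ (Fin n),
        IsOutwardUnitNormal (zonotope A) F u ↔ IsOutwardUnitNormal (zonotope B) (φ F) u)
    (hvolume : ∀ F : FaceLattice (zonotope A), IsFacet (zonotope A) F →
      μHE[n - 1] (F : Set (EuclideanSpace ℝ (Fin n))) =
        μHE[n - 1] (φ F : Set (EuclideanSpace ℝ (Fin n)))) :
    AreCongruent (zonotope A) (zonotope B) := by
  have ha := span_range_toLp_col A hA
  have hb := span_range_toLp_col B hB
  obtain ⟨c, hc⟩ := exists_translation_of_faceDet_eq hn ha hb fun u hu =>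
    faceDet_eq_of_orderIso hn ha hb φ hnormal hvolume hu
  exact ⟨IsometryEquiv.addRight c, hc⟩
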